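/- Let $V$ be a Minkowski plane, i.e. a two-dimensional real vector space with a norm $\|\cdot\|$, let $[\cdot,\cdot]$ be a symplectic form on $V$ (a non-degenerate bilinear form with $[x,x]=0$ for all $x$), and let area be measured by a translation-invariant (Haar) measure on $V$, with any choice of the unit of area. A convex body is a convex, closed, bounded subset of $V$ with interior points, and its perimeter is measured in the norm: $\mathrm{per}(C)$ is the supremum (equivalently, the limit) of the $\|\cdot\|$-perimeters of the convex polygons inscribed in $C$. The antinorm on $V$ is $$\|x\|_{\mathrm a}=\sup\{[x,y] : \|y\|=1\},$$ and an anticircle (regarded as a convex body) is a ball of the antinorm, i.e. a set of the form $\{x\in V:\|x-v\|_{\mathrm a}\le\rho\}$ with $v\in V$ and $\rho>0$. Then the solutions of the isoperimetric problem in $V$ are exactly the anticircles. That is, for every set $C\subseteq V$: 1. $C$ is a convex body such that $$\frac{\mathrm{per}(C)^2}{\mathrm{area}(C)}\le\frac{\mathrm{per}(D)^2}{\mathrm{area}(D)}$$ for all convex bodies $D\subseteq V$, if and only if $C$ is an anticircle. 2. Equivalently, $C$ is a convex body having the largest area among all convex bodies with the same perimeter as $C$, if and only if $C$ is an anticircle.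 -/

import Mathlib

open MeasureTheory
open scoped ENNReal

namespace MinkowskiPlane

variable {V : Type*} [NormedAddCommGroup V] [NormedSpace ℝ V]

/-- A convex body: a convex, closed and bounded set with interior points. -/
structure IsConvexBody (C : Set V) : Prop where
  convex : Convex ℝ C
  isClosed : IsClosed C
  isBounded : Bornology.IsBounded C
  interior_nonempty : (interior C).Nonempty

/-- A symplectic form on `V`: a non-degenerate bilinear form `B` with `B x x = 0` for all `x`. -/
structure IsSymplectic (B : LinearMap.BilinForm ℝ V) : Prop where
  isAlt : B.IsAlt
  nondegenerate : B.Nondegenerate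

/-- The antinorm of `x` with respect to the norm of `V` and the bilinear form `B`:
the supremum of `B x y` over all unit vectors `y`. -/
noncomputable def antinorm (B : LinearMap.BilinForm ℝ V) (x : V) : ℝ :=
  sSup {r : ℝ | ∃ y : V, ‖y‖ = 1 ∧ r = B x y}

/-- `C` is a (filled) anticircle: a ball of the antinorm, of some centre `v` and some
radius `ρ > 0`, i.e. `C = ρ I + v` where `I` is the unit ball of the antinorm. -/
def IsAnticircle (B : LinearMap.BilinForm ℝ V) (C : Set V) : Prop :=
  ∃ (v : V) (ρ : ℝ), 0 < ρ ∧ C = {x : V | antinorm B (x - v) ≤ ρ}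

/-- The points `p 0, …, p (n + 2)` are the successive vertices of a convex polygon, enumerated
in the positive direction for the orientation given by `B`: any three of them, taken in the order
of their indices, form a non-degenerate positively oriented triangle. -/
def IsConvexPolygon (B : LinearMap.BilinForm ℝ V) {n : ℕ} (p : Fin (n + 3) → V) : Prop :=
  ∀ i j k : Fin (n + 3), i < j → j < k → 0 < B (p j - p i) (p k - p i)

/-- The perimeter, in the norm, of the polygon with successive vertices `p 0, …, p (n + 2)`
(`i + 1` is taken cyclically, so the last side joins `p (n + 2)` to `p 0`). -/
noncomputable def polygonPerimeter {n : ℕ} (p : Fin (n + 3) → V) : ℝ≥0∞ :=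
  ∑ i : Fin (n + 3), edist (p i) (p (i + 1))

/-- The perimeter of `C` in the norm: the supremum of the perimeters of the convex polygons
inscribed in `C`, i.e. with all vertices on the boundary of `C`.  (Inserting further vertices does
not decrease the perimeter, so that this supremum is the limit under refinement.  The form `B`
only serves to say in which order the vertices are enumerated.) -/
noncomputable def perimeter (B : LinearMap.BilinForm ℝ V) (C : Set V) : ℝ≥0∞ :=
  ⨆ (n : ℕ) (p : Fin (n + 3) → V) (_ : IsConvexPolygon B p) (_ : ∀ i, p i ∈ frontier C),
    polygonPerimeter p

/-- The isoperimetric ratio `perimeter² / area`; the area is given by the measure `μ`. -/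
noncomputable def isoperimetricRatio [MeasurableSpace V] (B : LinearMap.BilinForm ℝ V)
    (μ : Measure V) (C : Set V) : ℝ≥0∞ :=
  perimeter B C ^ 2 / μ C

end MinkowskiPlane

namespace MinkowskiPlane

open scoped Pointwise

set_option linter.unusedSectionVars false

/-! ### Slices of plane convex sets along the first axis -/

/-! Let I be the polar of the unit ball under `B` (the unit ball of the antinorm), A its area, P the
perimeter of C, and c the ratio of `μ` to symplectic area. Everything rests on a Bonnesen inequality
(`IsConvexBody.exists_inscribed_antiball`): for some translate x + sI contained in C, area(C) ≤ csP
− s²A. Since 4A(csP − s²A) = (cP)² − (cP − 2sA)², this gives 4A·area(C) ≤ (cP)². Equality forces cP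
= 2sA and area(C) = s²A, so the copy of sI fills C. Anticircles do attain equality, because cP ≤ 2ρA
for the one of radius ρ (`perimeter_image_antiball_le`).

For the Bonnesen inequality, first replace the norm by a sum x ↦ Σ|B a x| over a finite list; its
antiball is a zonotope Z. Around a convex polygon a linear functional varies by exactly twice its
width, so the perimeter of C in such a norm is 2W, where W is the sum of the widths of C. By Fubini,
eroding by a segment [-a, a] costs at most 2c times the width along `B a`. Hence eroding by tZ costs
at most 2ctW to first order, while W itself shrinks linearly in t (`totalWidth_erosion_le`).
Integrating gives area(C) ≤ area(C_t) + 2ctW − t²·area(Z) (`measure_le_measure_erosion_sub`,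
`measure_zonotope`). For the largest t such that a translate of tZ fits in C, the eroded set C_t has
no interior, hence no area.

In dimension two these sums approximate every norm (`exists_zonoNorm_approx`), because the
difference body of a polygon is a zonotope; compactness of the set of inscribed homothets of I
absorbs the error. -/

theorem volume_le_volume_erosion_real {S : Set ℝ} (hS : IsCompact S) (hc : Convex ℝ S) :
    volume S ≤ volume {x | x + 1 ∈ S ∧ x - 1 ∈ S} + 2 := by
  rcases S.eq_empty_or_nonempty with rfl | hne
  · simp
  have h := eq_Icc_of_connected_compact ⟨hne, hc.isPreconnected⟩ hS
  set p := sInf S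
  set q := sSup S
  have hsub : Set.Icc (p + 1) (q - 1) ⊆ {x | x + 1 ∈ S ∧ x - 1 ∈ S} := by
    intro x hx
    rw [Set.mem_ofPred_eq, h]
    exact ⟨⟨by linarith [hx.1], by linarith [hx.2]⟩, ⟨by linarith [hx.1], by linarith [hx.2]⟩⟩
  calc volume S = ENNReal.ofReal (q - p) := by rw [h, Real.volume_Icc]
    _ ≤ ENNReal.ofReal ((q - 1 - (p + 1)) + 2) := by
        apply ENNReal.ofReal_le_ofReal; linarith
    _ ≤ ENNReal.ofReal (q - 1 - (p + 1)) + ENNReal.ofReal 2 := ENNReal.ofReal_add_le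
    _ = volume (Set.Icc (p + 1) (q - 1)) + 2 := by rw [Real.volume_Icc]; simp
    _ ≤ _ := by gcongr

theorem volume_add_two_le_volume_dilation_real {S : Set ℝ} (hS : IsCompact S) (hc : Convex ℝ S)
    (hne : S.Nonempty) :
    volume S + 2 ≤ volume {x | ∃ r ∈ Set.Icc (-1 : ℝ) 1, x + r ∈ S} := by
  have h := eq_Icc_of_connected_compact ⟨hne, hc.isPreconnected⟩ hS
  set p := sInf S
  set q := sSup S
  have hpq : p ≤ q := by
    rw [h] at hne
    exact Set.nonempty_Icc.1 hne
  have hsub : Set.Icc (p - 1) (q + 1) ⊆ {x | ∃ r ∈ Set.Icc (-1 : ℝ) 1, x + r ∈ S} := by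
    intro x hx
    rw [Set.mem_ofPred_eq, h]
    rcases le_total x p with h1 | h1
    · exact ⟨p - x, ⟨by linarith, by linarith [hx.1]⟩, ⟨by linarith, by linarith⟩⟩
    rcases le_total x q with h2 | h2
    · exact ⟨0, ⟨by norm_num, by norm_num⟩, ⟨by linarith, by linarith⟩⟩
    · exact ⟨q - x, ⟨by linarith [hx.2], by linarith⟩, ⟨by linarith, by linarith⟩⟩
  calc volume S + 2 = ENNReal.ofReal (q - p) + ENNReal.ofReal 2 := by
        rw [h, Real.volume_Icc]; simp
    _ = volume (Set.Icc (p - 1) (q + 1)) := by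
        rw [Real.volume_Icc, ← ENNReal.ofReal_add (by linarith) (by norm_num)]
        congr 1; ring
    _ ≤ _ := by gcongr

theorem isCompact_slice {K : Set (ℝ × ℝ)} (hK : IsCompact K) (y : ℝ) :
    IsCompact ((fun x => (x, y)) ⁻¹' K) := by
  have : ((fun x => (x, y)) ⁻¹' K) = Prod.fst '' (K ∩ Prod.snd ⁻¹' {y}) := by
    ext x
    constructor
    · exact fun hx => ⟨(x, y), ⟨hx, rfl⟩, rfl⟩
    · rintro ⟨⟨a, b⟩, ⟨h1, h2⟩, rfl⟩
      simp only [Set.mem_preimage, Set.mem_singleton_iff] at h2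
      subst h2
      exact h1
  rw [this]
  exact (hK.inter_right (isClosed_singleton.preimage continuous_snd)).image continuous_fst

theorem convex_slice {K : Set (ℝ × ℝ)} (hc : Convex ℝ K) (y : ℝ) :
    Convex ℝ ((fun x => (x, y)) ⁻¹' K) := by
  intro a ha b hb s t hs ht hst
  have := hc ha hb hs ht hst
  simp only [Prod.smul_mk, Prod.mk_add_mk, smul_eq_mul] at this
  rwa [← add_mul, hst, one_mul] at this

/-- Cavalieri: each horizontal slice is an interval that loses at most length 2, and only heights in
[m, M] meet K. -/
theorem volume_le_volume_erosion {K : Set (ℝ × ℝ)} (hK : IsCompact K) (hc : Convex ℝ K)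
    {m M : ℝ} (hm : ∀ x ∈ K, x.2 ∈ Set.Icc m M) :
    volume K ≤ volume {x | x + (1, 0) ∈ K ∧ x - (1, 0) ∈ K} + ENNReal.ofReal (2 * (M - m)) := by
  have hcl : IsClosed {x | x + ((1, 0) : ℝ × ℝ) ∈ K ∧ x - (1, 0) ∈ K} :=
    (hK.isClosed.preimage (continuous_id.add continuous_const)).inter
      (hK.isClosed.preimage (continuous_id.sub continuous_const))
  rw [Measure.volume_eq_prod, Measure.prod_apply_symm hK.measurableSet,
    Measure.prod_apply_symm hcl.measurableSet]
  have h2 : ENNReal.ofReal (2 * (M - m)) = ∫⁻ y, (Set.Icc m M).indicator (fun _ => 2) y := by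
    rw [lintegral_indicator measurableSet_Icc, setLIntegral_const, Real.volume_Icc,
      ENNReal.ofReal_mul (by norm_num)]
    simp
  rw [h2, ← lintegral_add_right _ (measurable_const.indicator measurableSet_Icc)]
  refine lintegral_mono fun y => ?_
  by_cases hy : y ∈ Set.Icc m M
  · rw [Set.indicator_of_mem hy]
    refine (volume_le_volume_erosion_real (isCompact_slice hK y) (convex_slice hc y)).trans ?_
    gcongr
    intro x hx
    simpa using hx
  · have : (fun x => (x, y)) ⁻¹' K = ∅ := by
      ext x
      simp only [Set.mem_preimage, Set.mem_empty_iff_false, iff_false]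
      exact fun h => hy (hm _ h)
    simp [this]

/-- Each nonempty slice gains at least length 2, and by convexity every height between those of p
and q has a nonempty slice. -/
theorem volume_add_le_volume_dilation {K : Set (ℝ × ℝ)} (hK : IsCompact K) (hc : Convex ℝ K)
    {p q : ℝ × ℝ} (hp : p ∈ K) (hq : q ∈ K) :
    volume K + ENNReal.ofReal (2 * (q.2 - p.2)) ≤
      volume {x | ∃ r ∈ Set.Icc (-1 : ℝ) 1, x + (r, 0) ∈ K} := by
  have hcl : IsClosed {x | ∃ r ∈ Set.Icc (-1 : ℝ) 1, x + (r, 0) ∈ K} := by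
    have : {x | ∃ r ∈ Set.Icc (-1 : ℝ) 1, x + (r, 0) ∈ K} =
        (fun z : (ℝ × ℝ) × ℝ => z.1 - (z.2, 0)) '' (K ×ˢ Set.Icc (-1 : ℝ) 1) := by
      ext x
      constructor
      · rintro ⟨r, hr, hx⟩
        exact ⟨(x + (r, 0), r), ⟨hx, hr⟩, by simp⟩
      · rintro ⟨⟨a, r⟩, ⟨h1, h2⟩, rfl⟩
        exact ⟨r, h2, by simpa using h1⟩
    rw [this]
    refine IsCompact.isClosed ((hK.prod isCompact_Icc).image ?_)
    fun_prop
  rw [Measure.volume_eq_prod, Measure.prod_apply_symm hK.measurableSet,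
    Measure.prod_apply_symm hcl.measurableSet]
  have h2 : ENNReal.ofReal (2 * (q.2 - p.2)) =
      ∫⁻ y, (Set.Icc p.2 q.2).indicator (fun _ => 2) y := by
    rw [lintegral_indicator measurableSet_Icc, setLIntegral_const, Real.volume_Icc,
      ENNReal.ofReal_mul (by norm_num)]
    simp
  rw [h2, ← lintegral_add_right _ (measurable_const.indicator measurableSet_Icc)]
  refine lintegral_mono fun y => ?_
  by_cases hne : ((fun x => (x, y)) ⁻¹' K).Nonempty
  · have := volume_add_two_le_volume_dilation_real (isCompact_slice hK y) (convex_slice hc y) hne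
    calc _ ≤ volume ((fun x => (x, y)) ⁻¹' K) + 2 := by
          gcongr
          by_cases hy : y ∈ Set.Icc p.2 q.2 <;> simp [hy]
      _ ≤ _ := by
          refine this.trans (measure_mono ?_)
          rintro x ⟨r, hr, hx⟩
          exact ⟨r, hr, by simpa using hx⟩
  · have hy : y ∉ Set.Icc p.2 q.2 := by
      intro hy
      apply hne
      have h3 : y ∈ segment ℝ p.2 q.2 := by
        rwa [segment_eq_Icc (hy.1.trans hy.2)]
      obtain ⟨s, t, hs, ht, hst, rfl⟩ := h3
      refine ⟨s * p.1 + t * q.1, ?_⟩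
      have := hc hp hq hs ht hst
      exact this
    rw [Set.not_nonempty_iff_eq_empty.1 hne, Set.indicator_of_notMem hy]
    simp

/-! ### Symplectic charts -/

variable {V : Type*} [NormedAddCommGroup V] [NormedSpace ℝ V]

theorem IsSymplectic.apply_self {B : LinearMap.BilinForm ℝ V} (hB : IsSymplectic B) (x : V) :
    B x x = 0 := hB.isAlt x

theorem IsSymplectic.apply_swap {B : LinearMap.BilinForm ℝ V} (hB : IsSymplectic B) (x y : V) :
    B y x = -B x y := (LinearMap.IsAlt.neg hB.isAlt x y).symm

theorem IsSymplectic.exists_apply_eq_one {B : LinearMap.BilinForm ℝ V} (hB : IsSymplectic B)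
    {a : V} (ha : a ≠ 0) : ∃ b, B a b = 1 := by
  by_contra! h
  refine ha (hB.nondegenerate.1 a fun b => ?_)
  by_contra hb
  exact h ((B a b)⁻¹ • b) (by simp [hb])

theorem IsSymplectic.eq_smul_add_smul {B : LinearMap.BilinForm ℝ V} (hB : IsSymplectic B)
    (hV : Module.finrank ℝ V = 2) {a b : V} (hab : B a b = 1) (x : V) :
    x = B x b • a + B a x • b := by
  have hba : B b a = -1 := by rw [hB.apply_swap a b, hab]
  have hli : LinearIndependent ℝ ![a, b] := by
    rw [LinearIndependent.pair_iff]
    intro s t h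
    have h1 : B a (s • a + t • b) = 0 := by rw [h, map_zero]
    have h2 : B (s • a + t • b) b = 0 := by rw [h, map_zero, LinearMap.zero_apply]
    simp [hB.apply_self, hab] at h1 h2
    exact ⟨h2, h1⟩
  let bs := basisOfLinearIndependentOfCardEqFinrank hli (by simp [hV])
  have hx := bs.sum_repr x
  simp only [bs, coe_basisOfLinearIndependentOfCardEqFinrank, Fin.sum_univ_two,
    Matrix.cons_val_zero, Matrix.cons_val_one] at hx
  generalize (basisOfLinearIndependentOfCardEqFinrank hli _).repr x = f at hx
  rw [← hx]
  simp [hB.apply_self, hab]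

/-- The coordinates attached to a pair of vectors `a`, `b` with `B a b = 1`. -/
noncomputable def chart {B : LinearMap.BilinForm ℝ V} (hB : IsSymplectic B)
    (hV : Module.finrank ℝ V = 2) {a b : V} (hab : B a b = 1) : (ℝ × ℝ) ≃ₗ[ℝ] V where
  toFun z := z.1 • a + z.2 • b
  invFun x := (B x b, B a x)
  map_add' y z := by simp only [Prod.fst_add, Prod.snd_add]; module
  map_smul' r z := by simp only [Prod.smul_fst, Prod.smul_snd, smul_eq_mul, RingHom.id_apply]; module
  left_inv z := by simp [hB.apply_self, hab]
  right_inv x := (hB.eq_smul_add_smul hV hab x).symm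

theorem chart_apply {B : LinearMap.BilinForm ℝ V} (hB : IsSymplectic B)
    (hV : Module.finrank ℝ V = 2) {a b : V} (hab : B a b = 1) (z : ℝ × ℝ) :
    chart hB hV hab z = z.1 • a + z.2 • b := rfl

theorem chart_symm_apply {B : LinearMap.BilinForm ℝ V} (hB : IsSymplectic B)
    (hV : Module.finrank ℝ V = 2) {a b : V} (hab : B a b = 1) (x : V) :
    (chart hB hV hab).symm x = (B x b, B a x) := rfl

theorem apply_chart {B : LinearMap.BilinForm ℝ V} (hB : IsSymplectic B)
    (hV : Module.finrank ℝ V = 2) {a b : V} (hab : B a b = 1) (z : ℝ × ℝ) :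
    B a (chart hB hV hab z) = z.2 := by
  simp [chart_apply, hB.apply_self, hab]

/-- All symplectic charts compare the measure with Lebesgue measure by the same factor. -/
theorem exists_measure_eq_chart [MeasurableSpace V] [BorelSpace V] {B : LinearMap.BilinForm ℝ V}
    (hB : IsSymplectic B) (hV : Module.finrank ℝ V = 2) (μ : Measure V) [μ.IsAddHaarMeasure] :
    ∃ c : ℝ, 0 < c ∧ ∀ (a b : V) (hab : B a b = 1) (S : Set V),
      μ S = ENNReal.ofReal c * volume (chart hB hV hab ⁻¹' S) := by
  have : FiniteDimensional ℝ V := Module.finite_of_finrank_eq_succ hV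
  have : Nontrivial V := Module.nontrivial_of_finrank_pos (R := ℝ) (by omega)
  obtain ⟨a₀, ha₀⟩ := exists_ne (0 : V)
  obtain ⟨b₀, hab₀⟩ := hB.exists_apply_eq_one ha₀
  let e := (chart hB hV hab₀).symm.toContinuousLinearEquiv
  have hν : (μ.map e).IsAddHaarMeasure := e.isAddHaarMeasure_map μ
  obtain ⟨c, hc0, hcT, hc⟩ : ∃ c : ℝ≥0∞, c ≠ 0 ∧ c ≠ ∞ ∧ μ.map e = c • volume := by
    refine ⟨Measure.addHaarScalarFactor (μ.map e) volume, ?_, by simp,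
      Measure.isAddLeftInvariant_eq_smul _ _⟩
    simpa using (Measure.addHaarScalarFactor_pos_of_isAddHaarMeasure (μ.map e) volume).ne'
  refine ⟨c.toReal, ENNReal.toReal_pos hc0 hcT, fun a b hab S => ?_⟩
  rw [ENNReal.ofReal_toReal hcT]
  have h1 : μ S = c * volume (chart hB hV hab₀ ⁻¹' S) := by
    have h2 : (μ.map e) (chart hB hV hab₀ ⁻¹' S) = μ S := by
      rw [show (e : V → ℝ × ℝ) = e.toHomeomorph.toMeasurableEquiv from rfl,
        MeasurableEquiv.map_apply]
      congr 1
      ext x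
      change chart hB hV hab₀ ((chart hB hV hab₀).symm x) ∈ S ↔ _
      simp
    rw [← h2, hc]; rfl
  rw [h1]
  congr 1
  let T : (ℝ × ℝ) →ₗ[ℝ] (ℝ × ℝ) :=
    (chart hB hV hab₀).symm.toLinearMap ∘ₗ (chart hB hV hab).toLinearMap
  -- The change of coordinates has determinant B a b = 1, since both charts turn `B` into the
  -- standard determinant.
  have hT : LinearMap.det T = 1 := by
    rw [← LinearMap.det_toMatrix (Module.Basis.finTwoProd ℝ), Matrix.det_fin_two]
    simp only [LinearMap.toMatrix_apply, T, LinearMap.comp_apply, LinearEquiv.coe_coe,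
      Module.Basis.finTwoProd_zero, Module.Basis.finTwoProd_one, chart_apply, chart_symm_apply,
      Module.Basis.coe_finTwoProd_repr]
    simp only [one_smul, zero_smul, add_zero, zero_add, Matrix.cons_val_zero,
      Matrix.cons_val_one]
    have h2 := hab
    rw [hB.eq_smul_add_smul hV hab₀ a, hB.eq_smul_add_smul hV hab₀ b] at h2
    simp [hB.apply_self, hB.apply_swap a₀ b₀, hab₀] at h2
    linarith
  have h3 : chart hB hV hab₀ ⁻¹' S = T '' (chart hB hV hab ⁻¹' S) := by
    ext z
    constructor
    · intro hz
      exact ⟨(chart hB hV hab).symm (chart hB hV hab₀ z), by simpa using hz, by simp [T]⟩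
    · rintro ⟨y, hy, rfl⟩
      simpa [T] using hy
  rw [h3, Measure.addHaar_image_linearMap, hT]
  simp

/-! ### Widths -/

/-- The width of `K` measured by the linear functional `B a`. -/
noncomputable def width (B : LinearMap.BilinForm ℝ V) (a : V) (K : Set V) : ℝ :=
  sSup {r : ℝ | ∃ x ∈ K, ∃ y ∈ K, r = B a (x - y)}

theorem continuous_apply_form [FiniteDimensional ℝ V] (B : LinearMap.BilinForm ℝ V) (a : V) :
    Continuous (B a) := LinearMap.continuous_of_finiteDimensional _

theorem width_le {B : LinearMap.BilinForm ℝ V} {a : V} {K : Set V} {r : ℝ} (hr : 0 ≤ r)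
    (h : ∀ x ∈ K, ∀ y ∈ K, B a (x - y) ≤ r) : width B a K ≤ r := by
  refine Real.sSup_le ?_ hr
  rintro _ ⟨x, hx, y, hy, rfl⟩
  exact h x hx y hy

theorem exists_width_eq [FiniteDimensional ℝ V] (B : LinearMap.BilinForm ℝ V) (a : V) {K : Set V}
    (hK : IsCompact K) (hne : K.Nonempty) : ∃ x ∈ K, ∃ y ∈ K, width B a K = B a (x - y) ∧
      ∀ z ∈ K, B a z ∈ Set.Icc (B a y) (B a x) := by
  obtain ⟨x, hx, hx'⟩ := hK.exists_isMaxOn hne (continuous_apply_form B a).continuousOn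
  obtain ⟨y, hy, hy'⟩ := hK.exists_isMinOn hne (continuous_apply_form B a).continuousOn
  refine ⟨x, hx, y, hy, ?_, fun z hz => ⟨hy' hz, hx' hz⟩⟩
  refine IsGreatest.csSup_eq ⟨⟨x, hx, y, hy, rfl⟩, ?_⟩
  rintro _ ⟨u, hu, v, hv, rfl⟩
  have h1 : B a u ≤ B a x := hx' hu
  have h2 : B a y ≤ B a v := hy' hv
  rw [map_sub, map_sub]
  linarith

theorem le_width [FiniteDimensional ℝ V] (B : LinearMap.BilinForm ℝ V) (a : V) {K : Set V}
    (hK : IsCompact K) {u v : V} (hu : u ∈ K) (hv : v ∈ K) : B a (u - v) ≤ width B a K := by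
  obtain ⟨x, hx, y, hy, h, h'⟩ := exists_width_eq B a hK ⟨u, hu⟩
  have h1 := (h' u hu).2
  have h2 := (h' v hv).1
  rw [h, map_sub, map_sub]
  linarith

theorem width_nonneg [FiniteDimensional ℝ V] (B : LinearMap.BilinForm ℝ V) (a : V) {K : Set V}
    (hK : IsCompact K) : 0 ≤ width B a K := by
  rcases K.eq_empty_or_nonempty with rfl | ⟨x, hx⟩
  · simp [width]
  · simpa using le_width B a hK hx hx

theorem width_mono [FiniteDimensional ℝ V] (B : LinearMap.BilinForm ℝ V) (a : V) {K L : Set V}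
    (hL : IsCompact L) (h : K ⊆ L) : width B a K ≤ width B a L :=
  width_le (width_nonneg B a hL) fun _ hx _ hy => le_width B a hL (h hx) (h hy)

theorem width_smul_le [FiniteDimensional ℝ V] (B : LinearMap.BilinForm ℝ V) (a : V) {K : Set V}
    (hK : IsCompact K) {t : ℝ} (ht : 0 ≤ t) : width B (t • a) K ≤ t * width B a K := by
  refine width_le (mul_nonneg ht (width_nonneg B a hK)) fun x hx y hy => ?_
  rw [map_smul, LinearMap.smul_apply, smul_eq_mul]
  exact mul_le_mul_of_nonneg_left (le_width B a hK hx hy) ht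

/-! ### Area of erosions and dilations by a segment -/

/-- `μ` is `c` times the area measured by the symplectic form. -/
def IsAreaFactor [MeasurableSpace V] {B : LinearMap.BilinForm ℝ V} (hB : IsSymplectic B)
    (hV : Module.finrank ℝ V = 2) (μ : Measure V) (c : ℝ) : Prop :=
  0 < c ∧ ∀ (a b : V) (hab : B a b = 1) (S : Set V),
    μ S = ENNReal.ofReal c * volume (chart hB hV hab ⁻¹' S)

theorem isCompact_chart_preimage {B : LinearMap.BilinForm ℝ V} (hB : IsSymplectic B)
    (hV : Module.finrank ℝ V = 2) {K : Set V} {a b : V} (hab : B a b = 1)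
    (hK : IsCompact K) :
    IsCompact (chart hB hV hab ⁻¹' K) :=
  (chart hB hV hab).toContinuousLinearEquiv.toHomeomorph.isCompact_preimage.2 hK

theorem convex_chart_preimage {B : LinearMap.BilinForm ℝ V} (hB : IsSymplectic B)
    (hV : Module.finrank ℝ V = 2) {K : Set V} {a b : V} (hab : B a b = 1)
    (hc : Convex ℝ K) :
    Convex ℝ (chart hB hV hab ⁻¹' K) :=
  hc.linear_preimage (chart hB hV hab).toLinearMap

theorem isCompact_erosion_segment {K : Set V} (hK : IsCompact K) (a : V) :
    IsCompact {x | x + a ∈ K ∧ x - a ∈ K} := by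
  have : {x | x + a ∈ K ∧ x - a ∈ K} =
      (Homeomorph.addRight a) ⁻¹' K ∩ (Homeomorph.addRight (-a)) ⁻¹' K := by
    ext x; simp [sub_eq_add_neg]
  rw [this]
  exact ((Homeomorph.addRight a).isCompact_preimage.2 hK).inter
    ((Homeomorph.addRight (-a)).isCompact_preimage.2 hK)

theorem isCompact_dilation_segment {K : Set V} (hK : IsCompact K) (a : V) :
    IsCompact {x | ∃ r ∈ Set.Icc (-1 : ℝ) 1, x + r • a ∈ K} := by
  have : {x | ∃ r ∈ Set.Icc (-1 : ℝ) 1, x + r • a ∈ K} =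
      (fun z : V × ℝ => z.1 - z.2 • a) '' (K ×ˢ Set.Icc (-1 : ℝ) 1) := by
    ext x
    constructor
    · rintro ⟨r, hr, hx⟩
      exact ⟨(x + r • a, r), ⟨hx, hr⟩, by simp⟩
    · rintro ⟨⟨a, r⟩, ⟨h1, h2⟩, rfl⟩
      exact ⟨r, h2, by simpa using h1⟩
  rw [this]
  refine (hK.prod isCompact_Icc).image ?_
  fun_prop

section Segment

variable [MeasurableSpace V] [BorelSpace V] {B : LinearMap.BilinForm ℝ V}
  {hB : IsSymplectic B} {hV : Module.finrank ℝ V = 2} {μ : Measure V} [μ.IsAddHaarMeasure]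
  {c : ℝ} {K : Set V}

theorem measure_le_measure_erosion_segment (hμ : IsAreaFactor hB hV μ c) (hK : IsCompact K)
    (hc : Convex ℝ K) (a : V) :
    μ.real K ≤ μ.real {x | x + a ∈ K ∧ x - a ∈ K} + c * (2 * width B a K) := by
  have : FiniteDimensional ℝ V := Module.finite_of_finrank_eq_succ hV
  have hw := width_nonneg B a hK
  rcases K.eq_empty_or_nonempty with rfl | hne
  · have := mul_nonneg hμ.1.le hw
    simp only [measureReal_empty, Set.mem_empty_iff_false, and_self]
    have := @measureReal_nonneg V _ μ {x : V | False}
    linarith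
  by_cases ha : a = 0
  · subst ha
    have := mul_nonneg hμ.1.le hw
    simp
    linarith
  obtain ⟨b, hab⟩ := hB.exists_apply_eq_one ha
  obtain ⟨x, hx, y, hy, hxy, h⟩ := exists_width_eq B a hK hne
  have hm : ∀ z ∈ chart hB hV hab ⁻¹' K, z.2 ∈ Set.Icc (B a y) (B a x) := by
    intro z hz
    rw [← apply_chart hB hV hab z]
    exact h _ hz
  have key := volume_le_volume_erosion (isCompact_chart_preimage hB hV hab hK)
    (convex_chart_preimage hB hV hab hc) hm
  have hE := (isCompact_erosion_segment hK a).measure_lt_top (μ := μ)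
  rw [← map_sub, ← hxy] at key
  have key2 : μ K ≤ μ {x | x + a ∈ K ∧ x - a ∈ K} +
      ENNReal.ofReal (c * (2 * width B a K)) := by
    rw [hμ.2 a b hab K, hμ.2 a b hab {x | x + a ∈ K ∧ x - a ∈ K}, ENNReal.ofReal_mul hμ.1.le,
      ← mul_add]
    gcongr
    refine key.trans (le_of_eq ?_)
    congr 2
    ext z
    have : chart hB hV hab (1, 0) = a := by simp [chart_apply]
    simp [map_add, map_sub, this]
  have := ENNReal.toReal_mono (by simp [hE.ne]) key2
  rwa [ENNReal.toReal_add hE.ne ENNReal.ofReal_ne_top, ENNReal.toReal_ofReal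
    (mul_nonneg hμ.1.le (by linarith))] at this

theorem measure_add_le_measure_dilation_segment (hμ : IsAreaFactor hB hV μ c) (hK : IsCompact K)
    (hc : Convex ℝ K) (hne : K.Nonempty) (a : V) :
    μ.real K + c * (2 * width B a K) ≤ μ.real {x | ∃ r ∈ Set.Icc (-1 : ℝ) 1, x + r • a ∈ K} := by
  have : FiniteDimensional ℝ V := Module.finite_of_finrank_eq_succ hV
  have hw := width_nonneg B a hK
  have hD := (isCompact_dilation_segment hK a).measure_lt_top (μ := μ)
  by_cases ha : a = 0
  · subst ha
    have : width B 0 K ≤ 0 := width_le le_rfl (by simp)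
    have h0 : width B 0 K = 0 := le_antisymm this hw
    rw [h0]
    simp only [mul_zero, add_zero]
    refine measureReal_mono ?_ hD.ne
    intro x hx
    exact ⟨0, by simp, by simpa using hx⟩
  obtain ⟨b, hab⟩ := hB.exists_apply_eq_one ha
  obtain ⟨x, hx, y, hy, hxy, h⟩ := exists_width_eq B a hK hne
  have key := volume_add_le_volume_dilation (isCompact_chart_preimage hB hV hab hK)
    (convex_chart_preimage hB hV hab hc) (p := (chart hB hV hab).symm y)
    (q := (chart hB hV hab).symm x) (by simpa using hy) (by simpa using hx)
  simp only [chart_symm_apply] at key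
  rw [← map_sub, ← hxy] at key
  have key2 : μ K + ENNReal.ofReal (c * (2 * width B a K)) ≤
      μ {x | ∃ r ∈ Set.Icc (-1 : ℝ) 1, x + r • a ∈ K} := by
    rw [hμ.2 a b hab K, hμ.2 a b hab {x | ∃ r ∈ Set.Icc (-1 : ℝ) 1, x + r • a ∈ K},
      ENNReal.ofReal_mul hμ.1.le, ← mul_add]
    gcongr
    refine key.trans (le_of_eq ?_)
    congr 1
    ext z
    have : ∀ r : ℝ, chart hB hV hab (r, 0) = r • a := by simp [chart_apply]
    simp [map_add, this]
  have := ENNReal.toReal_mono hD.ne key2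
  rwa [ENNReal.toReal_add hK.measure_lt_top.ne ENNReal.ofReal_ne_top, ENNReal.toReal_ofReal
    (mul_nonneg hμ.1.le (by linarith))] at this

end Segment

/-! ### Zonotopes -/

/-- The sum of the segments from `-a` to `a`, for `a` in the list. -/
def zonotope : List V → Set V
  | [] => {0}
  | a :: l => {x | ∃ r ∈ Set.Icc (-1 : ℝ) 1, x + r • a ∈ zonotope l}

/-- The support function of the zonotope of `l`, in terms of `B`. -/
noncomputable def zonoNorm (B : LinearMap.BilinForm ℝ V) (l : List V) (x : V) : ℝ :=
  (l.map fun a => |B a x|).sum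

theorem zonoNorm_cons (B : LinearMap.BilinForm ℝ V) (a : V) (l : List V) (x : V) :
    zonoNorm B (a :: l) x = |B a x| + zonoNorm B l x := by simp [zonoNorm]

theorem zonoNorm_nonneg (B : LinearMap.BilinForm ℝ V) (l : List V) (x : V) :
    0 ≤ zonoNorm B l x := by
  induction l with
  | nil => exact le_rfl
  | cons a l ih => rw [zonoNorm_cons]; positivity

theorem isCompact_zonotope (l : List V) : IsCompact (zonotope l) := by
  induction l with
  | nil => exact isCompact_singleton
  | cons a l ih => exact isCompact_dilation_segment ih a

theorem convex_zonotope (l : List V) : Convex ℝ (zonotope l) := by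
  induction l with
  | nil => exact convex_singleton 0
  | cons a l ih =>
    rintro x ⟨r, hr, hx⟩ y ⟨s, hs, hy⟩ p q hp hq hpq
    refine ⟨p * r + q * s, (convex_Icc (-1 : ℝ) 1) hr hs hp hq hpq, ?_⟩
    have := ih hx hy hp hq hpq
    convert this using 1
    module

theorem zero_mem_zonotope (l : List V) : (0 : V) ∈ zonotope l := by
  induction l with
  | nil => rfl
  | cons a l ih => exact ⟨0, by simp, by simpa using ih⟩

theorem neg_mem_zonotope {l : List V} {x : V} (hx : x ∈ zonotope l) : -x ∈ zonotope l := by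
  induction l generalizing x with
  | nil =>
    have : x = 0 := hx
    simp [this, zonotope]
  | cons a l ih =>
    obtain ⟨r, hr, hx⟩ := hx
    refine ⟨-r, ⟨by linarith [hr.2], by linarith [hr.1]⟩, ?_⟩
    have := ih hx
    convert this using 1
    module

theorem apply_le_zonoNorm (B : LinearMap.BilinForm ℝ V) {l : List V} {u : V}
    (hu : u ∈ zonotope l) (x : V) : B u x ≤ zonoNorm B l x := by
  induction l generalizing u with
  | nil =>
    have : u = 0 := hu
    simp [this, zonoNorm]
  | cons a l ih =>
    obtain ⟨r, hr, hu⟩ := hu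
    have h1 := ih hu
    rw [zonoNorm_cons]
    have h2 : -(r * B a x) ≤ |B a x| := by
      refine (neg_le_abs _).trans ?_
      rw [abs_mul]
      exact mul_le_of_le_one_left (abs_nonneg _) (abs_le.2 hr)
    simp only [map_add, map_smul, LinearMap.add_apply, LinearMap.smul_apply, smul_eq_mul] at h1
    linarith

theorem exists_apply_eq_zonoNorm (B : LinearMap.BilinForm ℝ V) (l : List V) (x : V) :
    ∃ u ∈ zonotope l, B u x = zonoNorm B l x := by
  induction l with
  | nil => exact ⟨0, rfl, by simp [zonoNorm]⟩
  | cons a l ih =>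
    obtain ⟨u, hu, h⟩ := ih
    rcases le_total 0 (B a x) with h0 | h0
    · refine ⟨u + a, ⟨-1, by norm_num, by simpa using hu⟩, ?_⟩
      rw [zonoNorm_cons, abs_of_nonneg h0, map_add, LinearMap.add_apply, h, add_comm]
    · refine ⟨u - a, ⟨1, by norm_num, by simpa using hu⟩, ?_⟩
      rw [zonoNorm_cons, abs_of_nonpos h0, map_sub, LinearMap.sub_apply, h]
      ring

/-- The sum of all `|B a b|` for `a`, `b` in the list. -/
noncomputable def zonoArea (B : LinearMap.BilinForm ℝ V) (l : List V) : ℝ :=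
  (l.map (zonoNorm B l)).sum

theorem zonoArea_cons {B : LinearMap.BilinForm ℝ V} (hB : IsSymplectic B) (a : V) (l : List V) :
    zonoArea B (a :: l) = zonoArea B l + 2 * zonoNorm B l a := by
  have h1 : zonoNorm B (a :: l) = fun x => |B a x| + zonoNorm B l x := by
    funext x; exact zonoNorm_cons B a l x
  have h2 : (l.map fun x => |B a x|).sum = zonoNorm B l a := by
    unfold zonoNorm
    congr 2
    funext x
    rw [hB.apply_swap x a, abs_neg]
  rw [zonoArea, List.map_cons, List.sum_cons, h1]
  simp only [hB.apply_self, abs_zero, zero_add]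
  rw [List.sum_map_add, h2, zonoArea]
  ring

/-- The points `x` such that `x + t • u ∈ K` for all `u` in the zonotope of `l`. -/
def erosion (K : Set V) (t : ℝ) (l : List V) : Set V := {x | ∀ u ∈ zonotope l, x + t • u ∈ K}

theorem erosion_subset (K : Set V) (t : ℝ) (l : List V) : erosion K t l ⊆ K := by
  intro x hx
  simpa using hx 0 (zero_mem_zonotope l)

theorem erosion_zero (K : Set V) (l : List V) : erosion K 0 l = K := by
  ext x
  exact ⟨fun h => erosion_subset K 0 l h, fun h u _ => by simpa using h⟩

theorem erosion_anti {K : Set V} (hc : Convex ℝ K) {s t : ℝ} (hs : 0 ≤ s) (hst : s ≤ t)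
    (l : List V) : erosion K t l ⊆ erosion K s l := by
  intro x hx u hu
  rcases hs.eq_or_lt with rfl | hs
  · simpa using erosion_subset K t l hx
  have ht := hs.trans_le hst
  have h := hc (erosion_subset K t l hx) (hx u hu) (a := 1 - s / t) (b := s / t)
    (by rw [sub_nonneg, div_le_one ht]; exact hst) (by positivity) (by ring)
  convert h using 1
  rw [smul_add, smul_smul, div_mul_cancel₀ _ ht.ne']
  module

theorem erosion_erosion_subset (K : Set V) (s t : ℝ) (l : List V) :
    erosion (erosion K s l) t l ⊆ erosion K (s + t) l := by
  intro x hx u hu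
  have := hx u hu u hu
  rwa [add_assoc, ← add_smul, add_comm t s] at this

theorem convex_erosion {K : Set V} (hc : Convex ℝ K) (t : ℝ) (l : List V) :
    Convex ℝ (erosion K t l) := by
  intro x hx y hy p q hp hq hpq u hu
  have := hc (hx u hu) (hy u hu) hp hq hpq
  convert this using 1
  rw [smul_add, smul_add, add_add_add_comm, ← add_smul, hpq, one_smul]

theorem isClosed_erosion {K : Set V} (hK : IsClosed K) (t : ℝ) (l : List V) :
    IsClosed (erosion K t l) := by
  have : erosion K t l = ⋂ u ∈ zonotope l, (fun x => x + t • u) ⁻¹' K := by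
    ext x; simp [erosion]
  rw [this]
  exact isClosed_biInter fun u _ => hK.preimage (by fun_prop)

theorem isCompact_erosion {K : Set V} (hK : IsCompact K) (t : ℝ) (l : List V) :
    IsCompact (erosion K t l) :=
  hK.of_isClosed_subset (isClosed_erosion hK.isClosed t l) (erosion_subset K t l)

/-- The sum of the widths of `K` measured by the elements of the list. -/
noncomputable def totalWidth (B : LinearMap.BilinForm ℝ V) (l : List V) (K : Set V) : ℝ :=
  (l.map fun a => width B a K).sum

theorem totalWidth_mono [FiniteDimensional ℝ V] (B : LinearMap.BilinForm ℝ V) (l : List V)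
    {K L : Set V} (hL : IsCompact L) (h : K ⊆ L) : totalWidth B l K ≤ totalWidth B l L :=
  List.sum_le_sum fun a _ => width_mono B a hL h

theorem totalWidth_nonneg [FiniteDimensional ℝ V] (B : LinearMap.BilinForm ℝ V) (l : List V)
    {K : Set V} (hK : IsCompact K) : 0 ≤ totalWidth B l K :=
  List.sum_nonneg (by simpa using fun a _ => width_nonneg B a hK)

/-- If x and y are extreme in the eroded set for `B a`, then x − t u and y + t u still lie in K,
with u the zonotope point where `B u a` is largest. Each width therefore drops by at least
2t·zonoNorm(a). -/
theorem totalWidth_erosion_le [FiniteDimensional ℝ V] {B : LinearMap.BilinForm ℝ V}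
    (hB : IsSymplectic B) (l : List V) {K : Set V} (hK : IsCompact K) {t : ℝ}
    (hne : (erosion K t l).Nonempty) :
    totalWidth B l (erosion K t l) + 2 * t * zonoArea B l ≤ totalWidth B l K := by
  rw [totalWidth, zonoArea, ← List.sum_map_mul_left, ← List.sum_map_add]
  refine List.sum_le_sum fun a _ => ?_
  obtain ⟨x, hx, y, hy, h, -⟩ := exists_width_eq B a (isCompact_erosion hK t l) hne
  obtain ⟨u, hu, hua⟩ := exists_apply_eq_zonoNorm B l a
  have := le_width B a hK (hx _ (neg_mem_zonotope hu)) (hy u hu)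
  rw [h, ← hua, hB.apply_swap a u]
  simp only [map_sub, map_add, map_smul, map_neg, smul_eq_mul] at this ⊢
  linarith

theorem width_zonotope [FiniteDimensional ℝ V] {B : LinearMap.BilinForm ℝ V}
    (hB : IsSymplectic B) (l : List V) (a : V) :
    width B a (zonotope l) = 2 * zonoNorm B l a := by
  apply le_antisymm
  · refine width_le (by have := zonoNorm_nonneg B l a; positivity) fun x hx y hy => ?_
    have h1 := apply_le_zonoNorm B (neg_mem_zonotope hx) a
    have h2 := apply_le_zonoNorm B hy a
    simp only [map_neg, LinearMap.neg_apply] at h1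
    rw [map_sub, hB.apply_swap x a, hB.apply_swap y a]
    linarith
  · obtain ⟨u, hu, hua⟩ := exists_apply_eq_zonoNorm B l a
    have := le_width B a (isCompact_zonotope l) (neg_mem_zonotope hu) hu
    rw [map_sub, map_neg, hB.apply_swap u a] at this
    linarith

section ZonotopeArea

variable [MeasurableSpace V] [BorelSpace V] {B : LinearMap.BilinForm ℝ V}
  {hB : IsSymplectic B} {hV : Module.finrank ℝ V = 2} {μ : Measure V} [μ.IsAddHaarMeasure]
  {c : ℝ} {K : Set V}

/-- First-order estimate, obtained by eroding by one segment at a time; the later widths are those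
of subsets of K. -/
theorem measure_le_measure_erosion (hμ : IsAreaFactor hB hV μ c) (hK : IsCompact K)
    (hc : Convex ℝ K) {t : ℝ} (ht : 0 ≤ t) (l : List V) :
    μ.real K ≤ μ.real (erosion K t l) + 2 * c * t * totalWidth B l K := by
  have : FiniteDimensional ℝ V := Module.finite_of_finrank_eq_succ hV
  induction l generalizing K with
  | nil =>
    have : erosion K t [] = K := by
      ext x; simp [erosion, zonotope]
    simp [this, totalWidth]
  | cons a l ih =>
    set K' := {x | x + t • a ∈ K ∧ x - t • a ∈ K} with hK'
    have hK'c : Convex ℝ K' :=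
      (hc.translate_preimage_left (t • a)).inter (by
        have := hc.translate_preimage_left (-(t • a))
        simp only [← sub_eq_add_neg] at this
        exact this)
    have hK'K : IsCompact K' := isCompact_erosion_segment hK _
    have hsub : K' ⊆ K := by
      intro x hx
      have := hc hx.1 hx.2 (a := 1 / 2) (b := 1 / 2) (by norm_num) (by norm_num) (by norm_num)
      convert this using 1
      module
    have h1 := measure_le_measure_erosion_segment hμ hK hc (t • a)
    have h2 := ih hK'K hK'c
    have h3 : μ.real (erosion K' t l) ≤ μ.real (erosion K t (a :: l)) := by
      -- If u + r a lies in the zonotope of l, then x + t u is the convex combination, with weights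
      -- (1 − r)/2 and (1 + r)/2, of x + t(u + r a) + t a and x + t(u + r a) − t a.
      refine measureReal_mono ?_ (isCompact_erosion hK t _).measure_lt_top.ne
      rintro x hx u ⟨r, hr, hu⟩
      have := hx _ hu
      have := hc this.1 this.2 (a := (1 - r) / 2) (b := (1 + r) / 2)
        (by linarith [hr.2]) (by linarith [hr.1]) (by ring)
      convert this using 1
      module
    have h4 : totalWidth B (a :: l) K = width B a K + totalWidth B l K := by simp [totalWidth]
    have h5 := mul_le_mul_of_nonneg_left (totalWidth_mono B l hK hsub)
      (by have := hμ.1; positivity : 0 ≤ 2 * c * t)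
    have h6 := mul_le_mul_of_nonneg_left (width_smul_le B a hK ht) hμ.1.le
    rw [h4]
    linarith

/-- The integrated form of the first-order estimate: erode in many small steps, using at each one
the reduced total width of the current set, and pass to the limit in the Riemann sum. -/
theorem measure_le_measure_erosion_sub (hμ : IsAreaFactor hB hV μ c) (hK : IsCompact K)
    (hc : Convex ℝ K) {t : ℝ} (ht : 0 ≤ t) (l : List V) (hne : (erosion K t l).Nonempty) :
    μ.real K ≤ μ.real (erosion K t l) +
      c * (2 * t * totalWidth B l K - 2 * t ^ 2 * zonoArea B l) := by
  have : FiniteDimensional ℝ V := Module.finite_of_finrank_eq_succ hV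
  have hc0 := hμ.1
  -- The j-th step costs at most 2cd(W − 2jd·zonoArea), and the sum of 4j d² over j < k is 2k(k −
  -- 1)d².
  have step : ∀ (d : ℝ), 0 ≤ d → ∀ k : ℕ, k * d ≤ t →
      μ.real K ≤ μ.real (erosion K (k * d) l) +
        c * (2 * (k * d) * totalWidth B l K - 2 * k * (k - 1) * d ^ 2 * zonoArea B l) := by
    intro d hd k
    induction k with
    | zero => simp [erosion_zero]
    | succ k ih =>
      intro hk
      push_cast at hk ⊢
      have hk' : k * d ≤ t := by linarith
      have hkd : 0 ≤ k * d := by positivity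
      have h1 := ih hk'
      have h2 := measure_le_measure_erosion hμ (isCompact_erosion hK (k * d) l)
        (convex_erosion hc (k * d) l) hd l
      have h3 := totalWidth_erosion_le hB l hK (hne.mono (erosion_anti hc hkd hk' l))
      have h4 : μ.real (erosion (erosion K (k * d) l) d l) ≤
          μ.real (erosion K ((k + 1) * d) l) := by
        refine measureReal_mono ?_ (isCompact_erosion hK _ l).measure_lt_top.ne
        rw [add_mul, one_mul]
        exact erosion_erosion_subset K _ _ l
      have h5 := mul_le_mul_of_nonneg_left h3 (by positivity : 0 ≤ 2 * c * d)
      linarith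
  have hlim : Filter.Tendsto (fun n : ℕ => μ.real (erosion K t l) +
      c * (2 * t * totalWidth B l K - 2 * t ^ 2 * zonoArea B l * (1 - 1 / ((n : ℝ) + 1))))
      Filter.atTop (nhds (μ.real (erosion K t l) +
      c * (2 * t * totalWidth B l K - 2 * t ^ 2 * zonoArea B l * (1 - 0)))) := by
    refine Filter.Tendsto.const_add _ (Filter.Tendsto.const_mul _ (Filter.Tendsto.const_sub _
      (Filter.Tendsto.const_mul _ (Filter.Tendsto.const_sub _ ?_))))
    exact tendsto_one_div_add_atTop_nhds_zero_nat
  rw [sub_zero, mul_one] at hlim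
  refine ge_of_tendsto' hlim fun n => ?_
  have hn : (0 : ℝ) < (n : ℝ) + 1 := by positivity
  have hnt : ((n + 1 : ℕ) : ℝ) * (t / (n + 1)) = t := by
    push_cast
    field_simp
  have h := step (t / (n + 1)) (by positivity) (n + 1) hnt.le
  rw [hnt] at h
  refine h.trans (le_of_eq ?_)
  congr 3
  push_cast
  field_simp

/-- The upper bound erodes the zonotope by itself down to a point, its total width being twice
`zonoArea`; the lower bound adds the segments one by one. -/
theorem measure_zonotope (hμ : IsAreaFactor hB hV μ c) (l : List V) :
    μ.real (zonotope l) = 2 * c * zonoArea B l := by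
  have : FiniteDimensional ℝ V := Module.finite_of_finrank_eq_succ hV
  have : Nontrivial V := Module.nontrivial_of_finrank_pos (R := ℝ) (by omega)
  apply le_antisymm
  · have hsub : erosion (zonotope l) 1 l ⊆ {0} := by
      intro x hx
      refine hB.nondegenerate.1 x fun y => ?_
      have key : ∀ y, B x y ≤ 0 := by
        intro y
        obtain ⟨u, hu, huy⟩ := exists_apply_eq_zonoNorm B l y
        have := apply_le_zonoNorm B (hx u hu) y
        rw [one_smul, map_add, LinearMap.add_apply, huy] at this
        linarith
      have := key (-y)
      rw [map_neg] at this
      linarith [key y]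
    have h0 : μ.real (erosion (zonotope l) 1 l) = 0 := by
      rw [measureReal_def, measure_mono_null hsub (measure_singleton 0)]
      rfl
    have := measure_le_measure_erosion_sub hμ (isCompact_zonotope l) (convex_zonotope l)
      zero_le_one l ⟨0, fun u hu => by simpa using hu⟩
    rw [h0] at this
    have h1 : totalWidth B l (zonotope l) = 2 * zonoArea B l := by
      rw [totalWidth, zonoArea, ← List.sum_map_mul_left]
      congr 2
      funext a
      exact width_zonotope hB l a
    rw [h1] at this
    linarith
  · induction l with
    | nil => simp [zonoArea]
    | cons a l ih =>
      have := measure_add_le_measure_dilation_segment hμ (isCompact_zonotope l)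
        (convex_zonotope l) ⟨0, zero_mem_zonotope l⟩ a
      rw [width_zonotope hB] at this
      rw [zonoArea_cons hB]
      change _ ≤ μ.real {x | ∃ r ∈ Set.Icc (-1 : ℝ) 1, x + r • a ∈ zonotope l}
      linarith

end ZonotopeArea

/-! ### Variation of linear functionals along polygons -/

theorem sum_cyclic_eq {n : ℕ} {M : Type*} {α : Type*} [AddCommMonoid M] (p : Fin (n + 1) → α)
    (g : α → α → M) : ∑ i, g (p i) (p (i + 1)) =
      ∑ i : Fin n, g (p i.castSucc) (p i.succ) + g (p (Fin.last n)) (p 0) := by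
  rw [Fin.sum_univ_castSucc, Fin.last_add_one]
  simp only [Fin.coeSucc_eq_succ]

/-- The two arcs of the cycle between k and l each contribute at least |g k − g l|. -/
theorem two_mul_sub_le_sum_cyclic {n : ℕ} (g : Fin (n + 1) → ℝ) (k l : Fin (n + 1)) :
    2 * |g k - g l| ≤ ∑ i, |g i - g (i + 1)| := by
  wlog hkl : k ≤ l generalizing k l
  · rw [abs_sub_comm]
    exact this l k (le_of_not_ge hkl)
  -- The default value g 0 makes G (n + 1) close the cycle.
  let G : ℕ → ℝ := fun j => if h : j < n + 1 then g ⟨j, h⟩ else g 0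
  have hG : ∀ i : Fin (n + 1), G i = g i := fun i => dif_pos i.2
  have hG' : ∀ i : Fin (n + 1), G (i + 1) = g (i + 1) := by
    intro i
    induction i using Fin.lastCases with
    | last => simp [G]
    | cast i => simp [G, Fin.succ]
  have hGn : G (n + 1) = G 0 := by simp [G]
  have hsum : ∑ i, |g i - g (i + 1)| = ∑ j ∈ Finset.range (n + 1), dist (G j) (G (j + 1)) := by
    rw [Finset.sum_range]
    refine Finset.sum_congr rfl fun i _ => ?_
    rw [hG, hG', Real.dist_eq]
  have hkl' : (k : ℕ) ≤ l := hkl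
  rw [hsum, Finset.range_eq_Ico, ← Finset.sum_Ico_consecutive _ (Nat.zero_le k) k.2.le,
    ← Finset.sum_Ico_consecutive _ hkl' l.2.le]
  have h1 := dist_le_Ico_sum_dist G (Nat.zero_le k)
  have h2 := dist_le_Ico_sum_dist G hkl'
  have h3 := dist_le_Ico_sum_dist G l.2.le
  rw [hGn] at h3
  have h4 := dist_triangle_left (G k) (G l) (G 0)
  rw [dist_comm (G 0) (G l)] at h4
  rw [← hG, ← hG, ← Real.dist_eq]
  linarith

/-- Non-degeneracy identifies V with its dual, so separating and norming functionals can be taken of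
the form `B w`. -/
theorem IsSymplectic.exists_apply_eq {B : LinearMap.BilinForm ℝ V} (hB : IsSymplectic B)
    (hV : Module.finrank ℝ V = 2) (g : V →ₗ[ℝ] ℝ) : ∃ w, ∀ x, B w x = g x := by
  have : Nontrivial V := Module.nontrivial_of_finrank_pos (R := ℝ) (by omega)
  obtain ⟨a, ha⟩ := exists_ne (0 : V)
  obtain ⟨b, hab⟩ := hB.exists_apply_eq_one ha
  refine ⟨g b • a - g a • b, fun x => ?_⟩
  conv_rhs => rw [hB.eq_smul_add_smul hV hab x]
  simp [hB.apply_swap x b]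
  ring

theorem IsSymplectic.smul_eq {B : LinearMap.BilinForm ℝ V} (hB : IsSymplectic B)
    (hV : Module.finrank ℝ V = 2) {u v : V} (huv : B u v ≠ 0) (w : V) :
    B u v • w = B w v • u + B u w • v := by
  have h := hB.eq_smul_add_smul hV (a := u) (b := (B u v)⁻¹ • v) (by simp [huv]) w
  conv_lhs => rw [h]
  simp only [map_smul, smul_eq_mul, smul_add, smul_smul]
  congr 2
  · rw [mul_inv_cancel_left₀ huv]
  · field_simp

/-- The points a, x, b, d are in cyclic convex position, so x − d is a nonnegative combination of a
− d and b − d with total weight at least 1: x lies beyond the chord ab as seen from d. If f d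
dominates at a and b, both terms are nonpositive under f and the excess weight only lowers f x. -/
theorem le_max_of_convex_position {B : LinearMap.BilinForm ℝ V} (hB : IsSymplectic B)
    (hV : Module.finrank ℝ V = 2) (f : V →ₗ[ℝ] ℝ) {a x b d : V} (h1 : 0 < B (x - a) (b - a))
    (h2 : 0 < B (x - a) (d - a)) (h3 : 0 < B (b - a) (d - a)) (h4 : 0 < B (b - x) (d - x))
    (hd : max (f a) (f b) ≤ f d) : f x ≤ max (f a) (f b) := by
  have e3 : B (a - d) (b - d) = B (b - a) (d - a) := by
    simp only [map_sub, LinearMap.sub_apply, hB.apply_self, hB.apply_swap a b, hB.apply_swap b d]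
    ring
  have e4 : B (x - d) (b - d) = B (b - x) (d - x) := by
    simp only [map_sub, LinearMap.sub_apply, hB.apply_self, hB.apply_swap x b, hB.apply_swap b d]
    ring
  have e2 : B (a - d) (x - d) = B (x - a) (d - a) := by
    simp only [map_sub, LinearMap.sub_apply, hB.apply_self, hB.apply_swap a x, hB.apply_swap x d]
    ring
  have e1 : B (b - x) (d - x) + B (x - a) (d - a) = B (b - a) (d - a) + B (x - a) (b - a) := by
    simp only [map_sub, LinearMap.sub_apply, hB.apply_self, hB.apply_swap a b,
      hB.apply_swap a x, hB.apply_swap x b]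
    ring
  have h := hB.smul_eq hV (u := a - d) (v := b - d) (by rw [e3]; exact h3.ne') (x - d)
  rw [e2, e3, e4] at h
  have hf := congrArg f h
  rw [map_smul, map_add, map_smul, map_smul, f.map_sub x, f.map_sub a, f.map_sub b, smul_eq_mul, smul_eq_mul,
    smul_eq_mul] at hf
  set m := max (f a) (f b)
  have ha : f a ≤ m := le_max_left _ _
  have hb : f b ≤ m := le_max_right _ _
  have k1 := mul_le_mul_of_nonneg_left (sub_le_sub_right ha (f d)) h4.le
  have k2 := mul_le_mul_of_nonneg_left (sub_le_sub_right hb (f d)) h2.le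
  have k3 : B (b - a) (d - a) * (f x - f d) ≤ B (b - a) (d - a) * (m - f d) := by
    have k4 := mul_nonneg h1.le (sub_nonneg.2 hd)
    have k5 : (B (b - x) (d - x) + B (x - a) (d - a)) * (m - f d) =
        (B (b - a) (d - a) + B (x - a) (b - a)) * (m - f d) := by rw [e1]
    linarith
  have := le_of_mul_le_mul_left k3 h3
  linarith

theorem IsConvexPolygon.comp_castSucc {B : LinearMap.BilinForm ℝ V} {n : ℕ}
    {p : Fin (n + 4) → V} (hp : IsConvexPolygon B p) :
    IsConvexPolygon B (n := n) fun i => p i.castSucc :=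
  fun _ _ _ hij hjk => hp _ _ _ (Fin.castSucc_lt_castSucc_iff.2 hij)
    (Fin.castSucc_lt_castSucc_iff.2 hjk)

theorem IsConvexPolygon.le_max_of_le_last {B : LinearMap.BilinForm ℝ V} (hB : IsSymplectic B)
    (hV : Module.finrank ℝ V = 2) {n : ℕ} {p : Fin (n + 4) → V} (hp : IsConvexPolygon B p)
    (f : V →ₗ[ℝ] ℝ)
    (hd : max (f (p 0)) (f (p (Fin.last (n + 2)).castSucc)) ≤ f (p (Fin.last (n + 3))))
    (k : Fin (n + 3)) :
    f (p k.castSucc) ≤ max (f (p 0)) (f (p (Fin.last (n + 2)).castSucc)) := by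
  rcases (Fin.zero_le k).eq_or_lt with rfl | h0
  · exact le_max_left _ _
  rcases (Fin.le_last k).eq_or_lt with rfl | h1
  · exact le_max_right _ _
  have h0' : (0 : Fin (n + 4)) < k.castSucc := h0
  have h1' : k.castSucc < (Fin.last (n + 2)).castSucc := h1
  have h2' : (Fin.last (n + 2)).castSucc < Fin.last (n + 3) := Fin.castSucc_lt_last _
  exact le_max_of_convex_position hB hV f (hp _ _ _ h0' h1') (hp _ _ _ h0' (h1'.trans h2'))
    (hp _ _ _ (h0'.trans h1') h2') (hp _ _ _ h1' h2') hd

/-- A linear functional is unimodal around a convex polygon, so its cyclic variation is at most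
twice its range. The induction removes the last vertex: a value between those of its two neighbours
leaves the variation unchanged. -/
theorem IsConvexPolygon.exists_sum_abs_le {B : LinearMap.BilinForm ℝ V} (hB : IsSymplectic B)
    (hV : Module.finrank ℝ V = 2) {n : ℕ} {p : Fin (n + 3) → V} (hp : IsConvexPolygon B p)
    (f : V →ₗ[ℝ] ℝ) :
    ∃ k l, ∑ i, |f (p i) - f (p (i + 1))| ≤ 2 * (f (p k) - f (p l)) := by
  induction n with
  | zero =>
    have hs : ∑ i, |f (p i) - f (p (i + 1))| =
        |f (p 0) - f (p 1)| + |f (p 1) - f (p 2)| + |f (p 2) - f (p 0)| := by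
      rw [Fin.sum_univ_three]; rfl
    rw [hs]
    rcases abs_cases (f (p 0) - f (p 1)) with ⟨e1, h1⟩ | ⟨e1, h1⟩ <;>
    rcases abs_cases (f (p 1) - f (p 2)) with ⟨e2, h2⟩ | ⟨e2, h2⟩ <;>
    rcases abs_cases (f (p 2) - f (p 0)) with ⟨e3, h3⟩ | ⟨e3, h3⟩ <;>
    rw [e1, e2, e3]
    · exact ⟨0, 1, by linarith⟩
    · exact ⟨0, 2, by linarith⟩
    · exact ⟨2, 1, by linarith⟩
    · exact ⟨0, 1, by linarith⟩
    · exact ⟨1, 0, by linarith⟩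
    · exact ⟨1, 2, by linarith⟩
    · exact ⟨2, 0, by linarith⟩
    · exact ⟨2, 0, by linarith⟩
  | succ n ih =>
    obtain ⟨k, l, hkl⟩ := ih hp.comp_castSucc
    rw [sum_cyclic_eq (n := n + 2) (fun i => p i.castSucc) fun x y => |f x - f y|] at hkl
    rw [sum_cyclic_eq (n := n + 3) p fun x y => |f x - f y|, Fin.sum_univ_castSucc]
    simp only [Fin.succ_castSucc, Fin.succ_last, Fin.castSucc_zero] at hkl ⊢
    have up := hp.le_max_of_le_last hB hV f
    have down := hp.le_max_of_le_last hB hV (-f)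
    simp only [LinearMap.neg_apply, max_neg_neg, neg_le_neg_iff] at down
    set a := f (p 0)
    set b := f (p (Fin.last (n + 2)).castSucc)
    set d := f (p (Fin.last (n + 3)))
    set s := ∑ i : Fin (n + 2), |f (p i.castSucc.castSucc) - f (p i.succ.castSucc)|
    rcases le_total (max a b) d with h | h
    -- The last vertex is a new maximum. The old maximum was then attained at one of its neighbours,
    -- so variation and twice the range grow by the same amount 2(d − max a b).
    · refine ⟨Fin.last (n + 3), l.castSucc, ?_⟩
      have h5 := up h k
      have ha : a ≤ d := (le_max_left _ _).trans h
      have hb : b ≤ d := (le_max_right _ _).trans h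
      change s + |b - d| + |d - a| ≤ 2 * (d - _)
      rw [abs_of_nonpos (sub_nonpos.2 hb), abs_of_nonneg (sub_nonneg.2 ha)]
      rcases le_total a b with hab | hab
      · rw [max_eq_right hab] at h5
        rw [abs_of_nonneg (sub_nonneg.2 hab)] at hkl
        linarith
      · rw [max_eq_left hab] at h5
        rw [abs_of_nonpos (sub_nonpos.2 hab)] at hkl
        linarith
    rcases le_total d (min a b) with h' | h'
    · refine ⟨k.castSucc, Fin.last (n + 3), ?_⟩
      have h5 := down h' l
      have ha : d ≤ a := h'.trans (min_le_left _ _)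
      have hb : d ≤ b := h'.trans (min_le_right _ _)
      change s + |b - d| + |d - a| ≤ 2 * (_ - d)
      rw [abs_of_nonneg (sub_nonneg.2 hb), abs_of_nonpos (sub_nonpos.2 ha)]
      rcases le_total a b with hab | hab
      · rw [min_eq_left hab] at h5
        rw [abs_of_nonneg (sub_nonneg.2 hab)] at hkl
        linarith
      · rw [min_eq_right hab] at h5
        rw [abs_of_nonpos (sub_nonpos.2 hab)] at hkl
        linarith
    · refine ⟨k.castSucc, l.castSucc, ?_⟩
      refine le_trans (le_of_eq ?_) hkl
      change s + |b - d| + |d - a| = s + |b - a|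
      rcases le_total a b with hab | hab
      · rw [max_eq_right hab] at h
        rw [min_eq_left hab] at h'
        rw [abs_of_nonneg (sub_nonneg.2 h), abs_of_nonneg (sub_nonneg.2 h'),
          abs_of_nonneg (sub_nonneg.2 hab)]
        ring
      · rw [max_eq_left hab] at h
        rw [min_eq_right hab] at h'
        rw [abs_of_nonpos (sub_nonpos.2 h), abs_of_nonpos (sub_nonpos.2 h'),
          abs_of_nonpos (sub_nonpos.2 hab)]
        ring

/-! ### Convex polygons with prescribed vertices -/

/-- Separate one point p0 strictly from the others by a functional `B w`, and sort the others by
slope as seen from p0; convex position gives the orientation of all remaining triples. -/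
theorem exists_convexPolygon_range_eq {B : LinearMap.BilinForm ℝ V} (hB : IsSymplectic B)
    (hV : Module.finrank ℝ V = 2) (E : Finset V) (hcard : 3 ≤ E.card)
    (hE : ∀ x ∈ E, x ∉ convexHull ℝ ((E : Set V) \ {x})) :
    ∃ (n : ℕ) (p : Fin (n + 3) → V), IsConvexPolygon B p ∧ Set.range p = E := by
  classical
  have : FiniteDimensional ℝ V := Module.finite_of_finrank_eq_succ hV
  obtain ⟨p0, hp0⟩ : E.Nonempty := Finset.card_pos.1 (by omega)
  set F := E.erase p0 with hF
  have hFcard : F.card = E.card - 1 := Finset.card_erase_of_mem hp0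
  have hFE : ((E : Set V) \ {p0}) = F := by simp [hF]
  obtain ⟨g, u, hgu, hug⟩ := geometric_hahn_banach_point_closed (convex_convexHull ℝ _)
    (F.finite_toSet.isCompact_convexHull (𝕜 := ℝ)).isClosed (hFE ▸ hE p0 hp0)
  obtain ⟨w, hw⟩ := hB.exists_apply_eq hV g.toLinearMap
  have hpos : ∀ q ∈ F, 0 < B w (q - p0) := by
    intro q hq
    rw [hw, map_sub]
    have := hug q (subset_convexHull ℝ _ hq)
    exact sub_pos.2 (hgu.trans this)
  have hw0 : w ≠ 0 := by
    rintro rfl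
    obtain ⟨q, hq⟩ : F.Nonempty := Finset.card_pos.1 (by omega)
    simpa using hpos q hq
  obtain ⟨w', hww⟩ := hB.exists_apply_eq_one hw0
  have hcross : ∀ x y, B x y = B w x * B w' y - B w y * B w' x := by
    intro x y
    conv_lhs => rw [hB.eq_smul_add_smul hV hww x, hB.eq_smul_add_smul hV hww y]
    simp [hB.apply_self, hww, hB.apply_swap w w', hB.apply_swap x w', hB.apply_swap y w']
    ring
  let key : V → ℝ := fun q => B w' (q - p0) / B w (q - p0)
  have hcross' : ∀ q ∈ F, ∀ q' ∈ F, B (q - p0) (q' - p0) =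
      B w (q - p0) * B w (q' - p0) * (key q' - key q) := by
    intro q hq q' hq'
    have := (hpos q hq).ne'
    have := (hpos q' hq').ne'
    rw [hcross]
    simp only [key]
    field_simp
  -- Equal slopes put q and q' on one ray from p0, and the nearer one would lie in the hull of p0
  -- and the other.
  have hinj : Set.InjOn key F := by
    intro q hq q' hq' hk
    by_contra hne
    wlog hle : B w (q - p0) ≤ B w (q' - p0) generalizing q q'
    · exact this hq' hq hk.symm (Ne.symm hne) (le_of_not_ge hle)
    have hq0 := hpos q hq
    have hq'0 := hpos q' hq'
    have hx0 : B (q - p0) (q' - p0) = 0 := by rw [hcross' q hq q' hq', hk, sub_self, mul_zero]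
    have h1 := hB.smul_eq hV (u := w) (v := q' - p0) hq'0.ne' (q - p0)
    rw [hx0, zero_smul, zero_add] at h1
    refine hE q (Finset.mem_of_mem_erase hq) ?_
    have h2 : p0 ∈ convexHull ℝ ((E : Set V) \ {q}) :=
      subset_convexHull ℝ _ ⟨hp0, fun h => Finset.ne_of_mem_erase hq h.symm⟩
    have h3 : q' ∈ convexHull ℝ ((E : Set V) \ {q}) :=
      subset_convexHull ℝ _ ⟨Finset.mem_of_mem_erase hq', fun h => hne h.symm⟩
    have h4 := (convex_convexHull ℝ ((E : Set V) \ {q})) h2 h3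
      (a := 1 - B w (q - p0) / B w (q' - p0)) (b := B w (q - p0) / B w (q' - p0))
      (by rw [sub_nonneg, div_le_one hq'0]; exact hle) (by positivity) (by ring)
    convert h4 using 1
    have h5 : q - p0 = (B w (q - p0) / B w (q' - p0)) • (q' - p0) := by
      rw [div_eq_inv_mul, mul_smul, ← h1, inv_smul_smul₀ hq'0.ne']
    calc q = p0 + (q - p0) := by abel
      _ = p0 + (B w (q - p0) / B w (q' - p0)) • (q' - p0) := by rw [← h5]
      _ = _ := by module
  obtain ⟨n, hn⟩ : ∃ n, E.card = n + 3 := ⟨E.card - 3, by omega⟩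
  have hKc : (F.image key).card = n + 2 := by
    rw [Finset.card_image_of_injOn, hFcard, hn]
    · rfl
    · exact hinj
  let o := (F.image key).orderEmbOfFin hKc
  have ho : ∀ i, ∃ q ∈ F, key q = o i := fun i =>
    Finset.mem_image.1 (Finset.orderEmbOfFin_mem _ hKc i)
  choose q hqF hqo using ho
  have hlt : ∀ {j k}, j < k → 0 < B (q j - p0) (q k - p0) := by
    intro j k hjk
    rw [hcross' _ (hqF j) _ (hqF k)]
    have := o.strictMono hjk
    rw [← hqo, ← hqo] at this
    exact mul_pos (mul_pos (hpos _ (hqF j)) (hpos _ (hqF k))) (by linarith)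
  refine ⟨n, Fin.cons p0 q, ?_, ?_⟩
  · intro i j k hij hjk
    obtain ⟨j, rfl⟩ := Fin.exists_succ_eq.2 (Fin.ne_zero_of_lt hij)
    obtain ⟨k, rfl⟩ := Fin.exists_succ_eq.2 (Fin.ne_zero_of_lt hjk)
    rw [Fin.succ_lt_succ_iff] at hjk
    simp only [Fin.cons_succ]
    induction i using Fin.cases with
    | zero => exact hlt hjk
    | succ i =>
      rw [Fin.succ_lt_succ_iff] at hij
      simp only [Fin.cons_succ]
      -- Otherwise q j would lie in the triangle p0, q i, q k: its weights s/r and t/r are positive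
      -- with sum at most 1.
      by_contra! hneg
      have d1 := hlt hij
      have d2 := hlt hjk
      have d3 := hlt (hij.trans hjk)
      have e : B (q j - q i) (q k - q i) = B (q i - p0) (q j - p0) + B (q j - p0) (q k - p0) -
          B (q i - p0) (q k - p0) := by
        simp only [map_sub, LinearMap.sub_apply, hB.apply_self, hB.apply_swap p0 (q i),
          hB.apply_swap p0 (q j), hB.apply_swap (q i) (q j)]
        ring
      have h1 := hB.smul_eq hV (u := q i - p0) (v := q k - p0) d3.ne' (q j - p0)
      set r := B (q i - p0) (q k - p0)
      set s := B (q j - p0) (q k - p0)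
      set t := B (q i - p0) (q j - p0)
      have hne : ∀ {a b}, a < b → q a ≠ q b := by
        intro a b hab h
        have := hlt hab
        rw [h, hB.apply_self] at this
        exact lt_irrefl _ this
      refine hE (q j) (Finset.mem_of_mem_erase (hqF j)) ?_
      have m0 : p0 ∈ (E : Set V) \ {q j} :=
        ⟨hp0, fun h => Finset.ne_of_mem_erase (hqF j) h.symm⟩
      have mi : q i ∈ (E : Set V) \ {q j} := ⟨Finset.mem_of_mem_erase (hqF i), hne hij⟩
      have mk : q k ∈ (E : Set V) \ {q j} := ⟨Finset.mem_of_mem_erase (hqF k), (hne hjk).symm⟩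
      have hcv := convex_convexHull ℝ ((E : Set V) \ {q j})
      have h2 : q j = (1 - s / r - t / r) • p0 + (s / r) • q i + (t / r) • q k := by
        have h5 : q j - p0 = (s / r) • (q i - p0) + (t / r) • (q k - p0) := by
          rw [div_eq_inv_mul, div_eq_inv_mul, mul_smul, mul_smul, ← smul_add, ← h1,
            inv_smul_smul₀ d3.ne']
        calc q j = p0 + (q j - p0) := by abel
          _ = _ := by rw [h5]; module
      have h3 := hcv.sum_mem (t := Finset.univ) (w := ![1 - s / r - t / r, s / r, t / r])
        (z := ![p0, q i, q k]) (by
          intro a _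
          fin_cases a
          · have : (s + t) / r ≤ 1 := by rw [div_le_one d3]; linarith
            rw [add_div] at this
            simp only [Fin.zero_eta, Matrix.cons_val_zero]
            linarith
          · exact (div_pos d2 d3).le
          · exact (div_pos d1 d3).le) (by
          rw [Fin.sum_univ_three]
          simp only [Matrix.cons_val_zero, Matrix.cons_val_one, Matrix.cons_val_two,
            Matrix.tail_cons, Matrix.head_cons]
          ring) (by
          intro a _
          fin_cases a
          · exact subset_convexHull ℝ _ m0
          · exact subset_convexHull ℝ _ mi
          · exact subset_convexHull ℝ _ mk)
      rw [Fin.sum_univ_three] at h3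
      simp only [Matrix.cons_val_zero, Matrix.cons_val_one, Matrix.cons_val_two,
        Matrix.tail_cons, Matrix.head_cons] at h3
      rw [← h2] at h3
      exact h3
  · rw [Fin.range_cons]
    ext x
    constructor
    · rintro (rfl | ⟨i, rfl⟩)
      · exact hp0
      · exact Finset.mem_of_mem_erase (hqF i)
    · intro hx
      by_cases hxp : x = p0
      · exact Or.inl hxp
      · have hxF : x ∈ F := Finset.mem_erase.2 ⟨hxp, hx⟩
        have h1 : key x ∈ Set.range o := by
          rw [Finset.range_orderEmbOfFin]
          exact Finset.mem_coe.2 (Finset.mem_image_of_mem _ hxF)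
        obtain ⟨i, hi⟩ := h1
        rw [← hqo] at hi
        exact Or.inr ⟨i, hinj (hqF i) hxF hi⟩

/-- The vertices are the extreme points of the hull. With at most two of them, S would lie on a
level line of some nonzero `B x`, which `hnc` excludes. -/
theorem exists_convexPolygon_of_finite {B : LinearMap.BilinForm ℝ V} (hB : IsSymplectic B)
    (hV : Module.finrank ℝ V = 2) {S : Set V} (hS : S.Finite)
    (hnc : ∀ x ≠ 0, ∃ s ∈ S, ∃ t ∈ S, B x s ≠ B x t) :
    ∃ (n : ℕ) (p : Fin (n + 3) → V), IsConvexPolygon B p ∧ (∀ i, p i ∈ S) ∧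
      S ⊆ convexHull ℝ (Set.range p) := by
  classical
  have : FiniteDimensional ℝ V := Module.finite_of_finrank_eq_succ hV
  have : Nontrivial V := Module.nontrivial_of_finrank_pos (R := ℝ) (by omega)
  have hsub : Set.extremePoints ℝ (convexHull ℝ S) ⊆ S := extremePoints_convexHull_subset
  have hfin := hS.subset hsub
  set E := hfin.toFinset with hE
  have hEc : (E : Set V) = Set.extremePoints ℝ (convexHull ℝ S) := hfin.coe_toFinset
  have hhull : convexHull ℝ (E : Set V) = convexHull ℝ S := by
    rw [← closure_convexHull_extremePoints (hS.isCompact_convexHull (𝕜 := ℝ))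
      (convex_convexHull ℝ S), ← hEc]
    exact ((E.finite_toSet.isCompact_convexHull (𝕜 := ℝ)).isClosed.closure_eq).symm
  have hcard : 3 ≤ E.card := by
    by_contra! hlt
    obtain ⟨u, v, huv⟩ : ∃ u v, (E : Set V) ⊆ {u, v} := by
      have h3 : E.card = 0 ∨ E.card = 1 ∨ E.card = 2 := by omega
      rcases h3 with h | h | h
      · exact ⟨0, 0, by simp [Finset.card_eq_zero.1 h]⟩
      · obtain ⟨u, hu⟩ := Finset.card_eq_one.1 h
        exact ⟨u, u, by simp [hu]⟩
      · obtain ⟨u, v, -, hu⟩ := Finset.card_eq_two.1 h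
        exact ⟨u, v, by simp [hu]⟩
    obtain ⟨x, hx, hxuv⟩ : ∃ x ≠ 0, B x u = B x v := by
      by_cases h : u = v
      · obtain ⟨x, hx⟩ := exists_ne (0 : V)
        exact ⟨x, hx, by rw [h]⟩
      · exact ⟨u - v, sub_ne_zero.2 h, by
          rw [← sub_eq_zero, ← map_sub, hB.apply_self]⟩
    have hconst : S ⊆ {y | B x y = B x u} := by
      refine (subset_convexHull ℝ S).trans ?_
      rw [← hhull]
      refine convexHull_min ?_ (convex_hyperplane (B x).isLinear _)
      intro y hy
      rcases huv hy with rfl | h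
      · rfl
      · rw [Set.mem_singleton_iff.1 h]
        exact hxuv.symm
    obtain ⟨s, hs, t, ht, hst⟩ := hnc x hx
    exact hst ((hconst hs).trans (hconst ht).symm)
  obtain ⟨n, p, hp, hr⟩ := exists_convexPolygon_range_eq hB hV E hcard (by
    intro x hx hx'
    have h1 : x ∈ Set.extremePoints ℝ (convexHull ℝ S) := by rw [← hEc]; exact hx
    rw [(convex_convexHull ℝ S).mem_extremePoints_iff_mem_sdiff_convexHull_sdiff] at h1
    refine h1.2 (convexHull_mono (Set.sdiff_subset_sdiff_left ?_) hx')
    rw [hEc]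
    exact extremePoints_subset)
  refine ⟨n, p, hp, fun i => hsub ?_, ?_⟩
  · rw [← hEc, ← hr]
    exact ⟨i, rfl⟩
  · rw [hr, hhull]
    exact subset_convexHull ℝ S

/-! ### Perimeters and widths -/

theorem IsConvexPolygon.sum_abs_le_width [FiniteDimensional ℝ V] {B : LinearMap.BilinForm ℝ V}
    (hB : IsSymplectic B) (hV : Module.finrank ℝ V = 2) {n : ℕ} {p : Fin (n + 3) → V}
    (hp : IsConvexPolygon B p) {K : Set V} (hK : IsCompact K) (hpK : ∀ i, p i ∈ K) (a : V) :
    ∑ i, |B a (p i - p (i + 1))| ≤ 2 * width B a K := by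
  obtain ⟨k, l, h⟩ := hp.exists_sum_abs_le hB hV (B a)
  simp only [← map_sub] at h
  exact h.trans (mul_le_mul_of_nonneg_left (le_width B a hK (hpK k) (hpK l)) (by norm_num))

theorem two_mul_sub_le_sum_of_mem_convexHull {n : ℕ} (p : Fin (n + 1) → V) (f : V →ₗ[ℝ] ℝ)
    {x y : V} (hx : x ∈ convexHull ℝ (Set.range p)) (hy : y ∈ convexHull ℝ (Set.range p)) :
    2 * (f x - f y) ≤ ∑ i, |f (p i - p (i + 1))| := by
  obtain ⟨k, hk⟩ := Finite.exists_max fun i => f (p i)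
  obtain ⟨l, hl⟩ := Finite.exists_min fun i => f (p i)
  have h1 : f x ≤ f (p k) := convexHull_min (t := {z | f z ≤ f (p k)})
    (by rintro _ ⟨i, rfl⟩; exact hk i) (convex_halfSpace_le f.isLinear _) hx
  have h2 : f (p l) ≤ f y := convexHull_min (t := {z | f (p l) ≤ f z})
    (by rintro _ ⟨i, rfl⟩; exact hl i) (convex_halfSpace_ge f.isLinear _) hy
  have h3 := two_mul_sub_le_sum_cyclic (fun i => f (p i)) k l
  simp only [← map_sub] at h3
  refine le_trans ?_ h3
  have := le_abs_self (f (p k - p l))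
  rw [map_sub] at this ⊢
  linarith

theorem polygonPerimeter_eq {n : ℕ} (p : Fin (n + 3) → V) :
    polygonPerimeter p = ENNReal.ofReal (∑ i, ‖p i - p (i + 1)‖) := by
  rw [ENNReal.ofReal_sum_of_nonneg fun _ _ => norm_nonneg _, polygonPerimeter]
  simp only [edist_dist, dist_eq_norm]

theorem sum_zonoNorm_le {n : ℕ} (B : LinearMap.BilinForm ℝ V) (e : Fin n → V) (l : List V)
    (K : Set V) (h : ∀ a ∈ l, ∑ i, |B a (e i)| ≤ 2 * width B a K) :
    ∑ i, zonoNorm B l (e i) ≤ 2 * totalWidth B l K := by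
  induction l with
  | nil => simp [zonoNorm, totalWidth]
  | cons a l ih =>
    simp only [zonoNorm_cons, totalWidth, Finset.sum_add_distrib, List.map_cons, List.sum_cons]
    have h1 := ih fun b hb => h b (List.mem_cons_of_mem _ hb)
    have h2 := h a List.mem_cons_self
    rw [totalWidth] at h1
    linarith

theorem le_sum_zonoNorm {n : ℕ} (B : LinearMap.BilinForm ℝ V) (e : Fin n → V) (l : List V)
    (K : Set V) (h : ∀ a ∈ l, 2 * width B a K ≤ ∑ i, |B a (e i)|) :
    2 * totalWidth B l K ≤ ∑ i, zonoNorm B l (e i) := by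
  induction l with
  | nil => simp [zonoNorm, totalWidth]
  | cons a l ih =>
    simp only [zonoNorm_cons, totalWidth, Finset.sum_add_distrib, List.map_cons, List.sum_cons]
    have h1 := ih fun b hb => h b (List.mem_cons_of_mem _ hb)
    have h2 := h a List.mem_cons_self
    rw [totalWidth] at h1
    linarith

theorem perimeter_le [FiniteDimensional ℝ V] {B : LinearMap.BilinForm ℝ V}
    (hB : IsSymplectic B) (hV : Module.finrank ℝ V = 2) {C : Set V} (hC : IsCompact C)
    {l : List V} {k : ℝ} (hk : 0 ≤ k) (hl : ∀ x, ‖x‖ ≤ k * zonoNorm B l x) :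
    perimeter B C ≤ ENNReal.ofReal (2 * k * totalWidth B l C) := by
  refine iSup_le fun n => iSup_le fun p => iSup_le fun hp => iSup_le fun hpC => ?_
  rw [polygonPerimeter_eq]
  refine ENNReal.ofReal_le_ofReal ?_
  have h1 := sum_zonoNorm_le B (fun i => p i - p (i + 1)) l C fun a _ =>
    hp.sum_abs_le_width hB hV hC (fun i => hC.isClosed.frontier_subset (hpC i)) a
  calc ∑ i, ‖p i - p (i + 1)‖ ≤ ∑ i, k * zonoNorm B l (p i - p (i + 1)) :=
        Finset.sum_le_sum fun i _ => hl _
    _ = k * ∑ i, zonoNorm B l (p i - p (i + 1)) := by rw [Finset.mul_sum]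
    _ ≤ k * (2 * totalWidth B l C) := mul_le_mul_of_nonneg_left h1 hk
    _ = _ := by ring

/-! ### Convex bodies -/

theorem IsConvexBody.isCompact [FiniteDimensional ℝ V] {C : Set V} (hC : IsConvexBody C) :
    IsCompact C := by
  have := FiniteDimensional.proper_real V
  exact Metric.isCompact_of_isClosed_isBounded hC.isClosed hC.isBounded

theorem IsConvexBody.nonempty {C : Set V} (hC : IsConvexBody C) : C.Nonempty :=
  hC.interior_nonempty.mono interior_subset

theorem exists_apply_lt_of_mem_interior {B : LinearMap.BilinForm ℝ V} (hB : IsSymplectic B)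
    {C : Set V} {x : V} (hx : x ∈ interior C) {a : V} (ha : a ≠ 0) :
    ∃ y ∈ C, B a x < B a y := by
  obtain ⟨b, hab⟩ := hB.exists_apply_eq_one ha
  have h1 : Filter.Tendsto (fun t : ℝ => x + t • b) (nhds 0) (nhds (x + (0 : ℝ) • b)) :=
    Continuous.tendsto (by fun_prop) 0
  rw [zero_smul, add_zero] at h1
  have h2 := (h1.mono_left (nhdsWithin_le_nhds (s := Set.Ioi 0))).eventually
    (mem_interior_iff_mem_nhds.1 hx)
  obtain ⟨t, ht, ht0⟩ := (h2.and self_mem_nhdsWithin).exists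
  exact ⟨_, ht, by simpa [hab] using ht0⟩

theorem IsConvexBody.width_pos [FiniteDimensional ℝ V] {B : LinearMap.BilinForm ℝ V}
    (hB : IsSymplectic B) {C : Set V} (hC : IsConvexBody C) {a : V} (ha : a ≠ 0) :
    0 < width B a C := by
  obtain ⟨x, hx⟩ := hC.interior_nonempty
  obtain ⟨y, hy, hxy⟩ := exists_apply_lt_of_mem_interior hB hx ha
  refine lt_of_lt_of_le ?_ (le_width B a hC.isCompact hy (interior_subset hx))
  rw [map_sub]
  linarith

theorem IsConvexBody.exists_frontier_width_eq [FiniteDimensional ℝ V]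
    {B : LinearMap.BilinForm ℝ V} (hB : IsSymplectic B) {C : Set V} (hC : IsConvexBody C)
    {a : V} (ha : a ≠ 0) :
    ∃ x ∈ frontier C, ∃ y ∈ frontier C, width B a C = B a (x - y) := by
  obtain ⟨x, hx, y, hy, h, h'⟩ := exists_width_eq B a hC.isCompact hC.nonempty
  refine ⟨x, ⟨subset_closure hx, fun hi => ?_⟩, y, ⟨subset_closure hy, fun hi => ?_⟩, h⟩
  · obtain ⟨z, hz, hlt⟩ := exists_apply_lt_of_mem_interior hB hi ha
    exact not_le_of_gt hlt (h' z hz).2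
  · obtain ⟨z, hz, hlt⟩ := exists_apply_lt_of_mem_interior hB hi (neg_ne_zero.2 ha)
    rw [map_neg, LinearMap.neg_apply, LinearMap.neg_apply, neg_lt_neg_iff] at hlt
    exact not_le_of_gt hlt (h' z hz).1

/-- Inscribe a polygon whose hull contains boundary points realising the width for every element of
l; each functional then varies around it by at least twice the width. -/
theorem IsConvexBody.le_perimeter {B : LinearMap.BilinForm ℝ V}
    (hB : IsSymplectic B) (hV : Module.finrank ℝ V = 2) {C : Set V} (hC : IsConvexBody C)
    {l : List V} (hl : ∀ x, zonoNorm B l x ≤ ‖x‖) :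
    ENNReal.ofReal (2 * totalWidth B l C) ≤ perimeter B C := by
  classical
  have : FiniteDimensional ℝ V := Module.finite_of_finrank_eq_succ hV
  have : Nontrivial V := Module.nontrivial_of_finrank_pos (R := ℝ) (by omega)
  have hex : ∀ a : V, ∃ x y, a ≠ 0 → x ∈ frontier C ∧ y ∈ frontier C ∧
      width B a C = B a (x - y) := by
    intro a
    by_cases ha : a = 0
    · exact ⟨0, 0, fun h => absurd ha h⟩
    · obtain ⟨x, hx, y, hy, h⟩ := hC.exists_frontier_width_eq hB ha
      exact ⟨x, y, fun _ => ⟨hx, hy, h⟩⟩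
  choose X Y hXY using hex
  obtain ⟨a₀, ha₀⟩ := exists_ne (0 : V)
  set v := X a₀ - Y a₀ with hv
  have hv0 : v ≠ 0 := by
    intro h0
    have h1 := hC.width_pos hB ha₀
    rw [(hXY a₀ ha₀).2.2, ← hv, h0, map_zero] at h1
    exact lt_irrefl _ h1
  -- Adding a₀ and v makes S non-collinear: a functional constant on S vanishes on v, so it is a
  -- multiple of `B v`, which has positive width on C.
  let L : Finset V := (insert a₀ (insert v l.toFinset)).filter (· ≠ 0)
  let S : Set V := ↑(L.image X ∪ L.image Y)
  have hXS : ∀ a ∈ L, X a ∈ S := fun a ha =>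
    Finset.mem_coe.2 (Finset.mem_union_left _ (Finset.mem_image_of_mem _ ha))
  have hYS : ∀ a ∈ L, Y a ∈ S := fun a ha =>
    Finset.mem_coe.2 (Finset.mem_union_right _ (Finset.mem_image_of_mem _ ha))
  have ha₀L : a₀ ∈ L := by simp [L, ha₀]
  have hvL : v ∈ L := by simp [L, hv0]
  obtain ⟨n, p, hp, hpS, hSp⟩ := exists_convexPolygon_of_finite hB hV (S := S)
    (Finset.finite_toSet _) (by
      intro x hx
      by_contra! hconst
      have h1 : B x v = 0 := by
        rw [hv, map_sub, hconst _ (hXS _ ha₀L) _ (hYS _ ha₀L), sub_self]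
      have h2 : B x (X v - Y v) = 0 := by
        rw [map_sub, hconst _ (hXS _ hvL) _ (hYS _ hvL), sub_self]
      obtain ⟨b, hb⟩ := hB.exists_apply_eq_one hv0
      have h3 := hB.eq_smul_add_smul hV hb x
      rw [hB.apply_swap x v, h1, neg_zero, zero_smul, add_zero] at h3
      have h4 : B x b ≠ 0 := by
        intro h4
        rw [h4, zero_smul] at h3
        exact hx h3
      rw [h3, map_smul, LinearMap.smul_apply, smul_eq_mul, ← (hXY v hv0).2.2] at h2
      exact mul_ne_zero h4 (hC.width_pos hB hv0).ne' h2)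
  have hpC : ∀ i, p i ∈ frontier C := by
    intro i
    have := Finset.mem_coe.1 (hpS i)
    simp only [Finset.mem_union, Finset.mem_image] at this
    rcases this with ⟨a, ha, h⟩ | ⟨a, ha, h⟩
    · rw [← h]; exact (hXY a (Finset.mem_filter.1 ha).2).1
    · rw [← h]; exact (hXY a (Finset.mem_filter.1 ha).2).2.1
  have key : ENNReal.ofReal (2 * totalWidth B l C) ≤ polygonPerimeter p := by
    rw [polygonPerimeter_eq]
    refine ENNReal.ofReal_le_ofReal ?_
    refine (le_sum_zonoNorm B (fun i => p i - p (i + 1)) l C fun a ha => ?_).trans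
      (Finset.sum_le_sum fun i _ => hl _)
    by_cases ha0 : a = 0
    · subst ha0
      have : width B 0 C ≤ 0 := width_le le_rfl (by simp)
      have h0 : 2 * width B 0 C ≤ 0 := by linarith
      simpa using h0
    · have haL : a ∈ L := by simp [L, ha, ha0]
      rw [(hXY a ha0).2.2, map_sub]
      exact two_mul_sub_le_sum_of_mem_convexHull p (B a) (hSp (hXS a haL)) (hSp (hYS a haL))
  exact key.trans (le_iSup₂_of_le n p (le_iSup₂_of_le hp hpC le_rfl))

/-! ### The unit ball of the antinorm and approximation of the norm -/

/-- The polar of the unit ball with respect to `B`; this is the unit ball of the antinorm. -/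
def antiball (B : LinearMap.BilinForm ℝ V) : Set V := {x | ∀ y, B x y ≤ ‖y‖}

theorem exists_mem_antiball_apply_eq {B : LinearMap.BilinForm ℝ V} (hB : IsSymplectic B)
    (hV : Module.finrank ℝ V = 2) (x : V) : ∃ u ∈ antiball B, B u x = ‖x‖ := by
  obtain ⟨g, hg, hgx⟩ := exists_dual_vector'' ℝ x
  obtain ⟨u, hu⟩ := hB.exists_apply_eq hV g.toLinearMap
  refine ⟨u, fun y => ?_, (hu x).trans hgx⟩
  rw [hu]
  calc g y ≤ ‖g y‖ := Real.le_norm_self _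
    _ ≤ ‖g‖ * ‖y‖ := g.le_opNorm y
    _ ≤ 1 * ‖y‖ := by gcongr
    _ = ‖y‖ := one_mul _

/-- Take norming functionals `B u` for a finite ε-net of the unit sphere. The convex polygon spanned
by the points u lies in the antiball, and the cyclic variation of `B x` around it is twice its range
there. -/
theorem exists_zonoNorm_approx {B : LinearMap.BilinForm ℝ V} (hB : IsSymplectic B)
    (hV : Module.finrank ℝ V = 2) {ε : ℝ} (h0 : 0 < ε) (h1 : ε < 1) :
    ∃ l : List V, ∀ x, (1 - ε) * ‖x‖ ≤ zonoNorm B l x ∧ zonoNorm B l x ≤ ‖x‖ := by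
  have : FiniteDimensional ℝ V := Module.finite_of_finrank_eq_succ hV
  have : ProperSpace V := FiniteDimensional.proper_real V
  have : Nontrivial V := Module.nontrivial_of_finrank_pos (R := ℝ) (by omega)
  obtain ⟨t, hts, htf, hcov⟩ := (isCompact_sphere (0 : V) 1).finite_cover_balls h0
  choose U hU hUx using exists_mem_antiball_apply_eq hB hV
  have hS : ∀ y, y ≠ 0 → ∃ s ∈ U '' t, (1 - ε) * ‖y‖ ≤ B s y := by
    intro y hy
    have hy' : 0 < ‖y‖ := norm_pos_iff.2 hy
    have hz : ‖y‖⁻¹ • y ∈ Metric.sphere (0 : V) 1 := by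
      simp [norm_smul, hy'.ne']
    obtain ⟨x, hx, hxz⟩ := Set.mem_iUnion₂.1 (hcov hz)
    refine ⟨U x, ⟨x, hx, rfl⟩, ?_⟩
    rw [Metric.mem_ball, dist_eq_norm, norm_sub_rev] at hxz
    have h2 := hU x (x - ‖y‖⁻¹ • y)
    rw [map_sub, hUx, map_smul, smul_eq_mul] at h2
    rw [mem_sphere_zero_iff_norm.1 (hts hx)] at h2
    have h3 : 1 - ε ≤ ‖y‖⁻¹ * B (U x) y := by linarith
    calc (1 - ε) * ‖y‖ ≤ (‖y‖⁻¹ * B (U x) y) * ‖y‖ := by gcongr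
      _ = B (U x) y := by field_simp
  have hS' : ∀ y, y ≠ 0 → ∃ s ∈ U '' t, ∃ s' ∈ U '' t, 2 * (1 - ε) * ‖y‖ ≤ B s y - B s' y := by
    intro y hy
    obtain ⟨s, hs, hsy⟩ := hS y hy
    obtain ⟨s', hs', hsy'⟩ := hS (-y) (neg_ne_zero.2 hy)
    rw [norm_neg, map_neg] at hsy'
    exact ⟨s, hs, s', hs', by linarith⟩
  obtain ⟨n, p, hp, hpS, hSp⟩ := exists_convexPolygon_of_finite hB hV (htf.image U) (by
    intro y hy
    obtain ⟨s, hs, s', hs', h⟩ := hS' y hy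
    refine ⟨s, hs, s', hs', fun heq => ?_⟩
    rw [hB.apply_swap y s, hB.apply_swap y s', heq, sub_self] at h
    have : 0 < (1 - ε) * ‖y‖ := mul_pos (by linarith) (norm_pos_iff.2 hy)
    linarith)
  -- The range of `B x` on the polygon is about 2‖x‖, so its variation is about 4‖x‖; hence the
  -- factor 1/4.
  refine ⟨List.ofFn fun i => (1 / 4 : ℝ) • (p i - p (i + 1)), fun x => ?_⟩
  have hN : zonoNorm B (List.ofFn fun i => (1 / 4 : ℝ) • (p i - p (i + 1))) x =
      1 / 4 * ∑ i, |B x (p i - p (i + 1))| := by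
    rw [zonoNorm, List.map_ofFn, List.sum_ofFn, Finset.mul_sum]
    refine Finset.sum_congr rfl fun i _ => ?_
    simp only [Function.comp_apply, map_smul, LinearMap.smul_apply, smul_eq_mul]
    rw [abs_mul, hB.apply_swap x, abs_neg, abs_of_nonneg (by norm_num : (0 : ℝ) ≤ 1 / 4)]
  rw [hN]
  constructor
  · by_cases hx : x = 0
    · subst hx; simp
    obtain ⟨s, hs, s', hs', h⟩ := hS' x hx
    have := two_mul_sub_le_sum_of_mem_convexHull p (B x) (hSp hs') (hSp hs)
    rw [hB.apply_swap s x, hB.apply_swap s' x] at this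
    linarith
  · obtain ⟨k, l, h⟩ := hp.exists_sum_abs_le hB hV (B x)
    simp only [← map_sub] at h
    have hm : ∀ i, p i ∈ antiball B := by
      intro i
      obtain ⟨z, -, hz⟩ := hpS i
      rw [← hz]
      exact hU z
    have e1 := hm k (-x)
    have e2 := hm l x
    rw [map_neg, norm_neg, hB.apply_swap x] at e1
    rw [hB.apply_swap x] at e2
    rw [map_sub] at h
    linarith

/-! ### The antinorm and its balls -/

theorem abs_apply_le_norm_of_mem_antiball {B : LinearMap.BilinForm ℝ V} {u : V}
    (hu : u ∈ antiball B) (y : V) : |B u y| ≤ ‖y‖ := by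
  refine abs_le.2 ⟨?_, hu y⟩
  have := hu (-y)
  rw [map_neg, norm_neg] at this
  linarith

theorem antinorm_le_iff [FiniteDimensional ℝ V] [Nontrivial V] (B : LinearMap.BilinForm ℝ V)
    (x : V) (ρ : ℝ) : antinorm B x ≤ ρ ↔ ∀ y, B x y ≤ ρ * ‖y‖ := by
  have hbdd : BddAbove {r : ℝ | ∃ y : V, ‖y‖ = 1 ∧ r = B x y} := by
    let g := LinearMap.toContinuousLinearMap (B x)
    refine ⟨‖g‖, ?_⟩
    rintro _ ⟨y, hy, rfl⟩
    calc B x y ≤ ‖g y‖ := Real.le_norm_self _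
      _ ≤ ‖g‖ * ‖y‖ := g.le_opNorm y
      _ = ‖g‖ := by rw [hy, mul_one]
  constructor
  · intro h y
    by_cases hy : y = 0
    · simp [hy]
    have hy' : 0 < ‖y‖ := norm_pos_iff.2 hy
    have h1 : B x (‖y‖⁻¹ • y) ≤ ρ :=
      (le_csSup hbdd ⟨_, by simp [norm_smul, hy'.ne'], rfl⟩).trans h
    rw [map_smul, smul_eq_mul] at h1
    calc B x y = (‖y‖⁻¹ * B x y) * ‖y‖ := by field_simp
      _ ≤ ρ * ‖y‖ := by gcongr
  · intro h
    obtain ⟨z, hz⟩ := exists_norm_eq V (zero_le_one' ℝ)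
    refine csSup_le ⟨_, z, hz, rfl⟩ ?_
    rintro _ ⟨y, hy, rfl⟩
    simpa [hy] using h y

theorem antinorm_sub_le_iff [FiniteDimensional ℝ V] [Nontrivial V] (B : LinearMap.BilinForm ℝ V)
    (x v : V) {ρ : ℝ} (hρ : 0 < ρ) :
    antinorm B (x - v) ≤ ρ ↔ ρ⁻¹ • (x - v) ∈ antiball B := by
  rw [antinorm_le_iff]
  refine forall_congr' fun y => ?_
  rw [map_smul, LinearMap.smul_apply, smul_eq_mul, inv_mul_le_iff₀ hρ]

theorem setOf_antinorm_le_eq [FiniteDimensional ℝ V] [Nontrivial V] (B : LinearMap.BilinForm ℝ V)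
    (v : V) {ρ : ℝ} (hρ : 0 < ρ) :
    {x : V | antinorm B (x - v) ≤ ρ} = (fun x => v + x) '' (ρ • antiball B) := by
  ext x
  rw [Set.mem_ofPred_eq, antinorm_sub_le_iff B x v hρ]
  constructor
  · intro h
    exact ⟨ρ • ρ⁻¹ • (x - v), Set.smul_mem_smul_set h, by simp [smul_smul, hρ.ne']⟩
  · rintro ⟨_, ⟨u, hu, rfl⟩, rfl⟩
    simpa [smul_smul, hρ.ne'] using hu

theorem convex_antiball (B : LinearMap.BilinForm ℝ V) : Convex ℝ (antiball B) := by
  intro x hx y hy p q hp hq hpq z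
  have h1 := mul_le_mul_of_nonneg_left (hx z) hp
  have h2 := mul_le_mul_of_nonneg_left (hy z) hq
  simp only [map_add, map_smul, LinearMap.add_apply, LinearMap.smul_apply, smul_eq_mul]
  calc _ ≤ p * ‖z‖ + q * ‖z‖ := add_le_add h1 h2
    _ = ‖z‖ := by rw [← add_mul, hpq, one_mul]

theorem zero_mem_antiball (B : LinearMap.BilinForm ℝ V) : (0 : V) ∈ antiball B :=
  fun y => by simp

theorem isConvexBody_antiball {B : LinearMap.BilinForm ℝ V} (hB : IsSymplectic B)
    (hV : Module.finrank ℝ V = 2) : IsConvexBody (antiball B) := by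
  have : FiniteDimensional ℝ V := Module.finite_of_finrank_eq_succ hV
  have : Nontrivial V := Module.nontrivial_of_finrank_pos (R := ℝ) (by omega)
  refine ⟨convex_antiball B, ?_, ?_, ?_⟩
  · have : antiball B = ⋂ y, {x | B.flip y x ≤ ‖y‖} := by
      ext x; simp [antiball]
    rw [this]
    exact isClosed_iInter fun y => isClosed_le (continuous_apply_form _ _) continuous_const
  · obtain ⟨a, ha⟩ := exists_ne (0 : V)
    obtain ⟨b, hab⟩ := hB.exists_apply_eq_one ha
    refine isBounded_iff_forall_norm_le.2 ⟨‖b‖ * ‖a‖ + ‖a‖ * ‖b‖, fun x hx => ?_⟩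
    have h1 := abs_apply_le_norm_of_mem_antiball hx b
    have h2 := abs_apply_le_norm_of_mem_antiball hx a
    rw [hB.apply_swap a x, abs_neg] at h2
    calc ‖x‖ = ‖B x b • a + B a x • b‖ := by rw [← hB.eq_smul_add_smul hV hab x]
      _ ≤ ‖B x b • a‖ + ‖B a x • b‖ := norm_add_le _ _
      _ = |B x b| * ‖a‖ + |B a x| * ‖b‖ := by simp [norm_smul]
      _ ≤ _ := by gcongr
  · let g := LinearMap.toContinuousBilinearMap B
    refine ⟨0, mem_interior.2 ⟨Metric.ball 0 (‖g‖ + 1)⁻¹, ?_, Metric.isOpen_ball,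
      Metric.mem_ball_self (by positivity)⟩⟩
    intro x hx y
    rw [mem_ball_zero_iff] at hx
    have h1 : ‖g‖ * ‖x‖ ≤ 1 := by
      calc ‖g‖ * ‖x‖ ≤ (‖g‖ + 1) * (‖g‖ + 1)⁻¹ := by gcongr; linarith
        _ = 1 := mul_inv_cancel₀ (by positivity)
    calc B x y ≤ ‖g x y‖ := Real.le_norm_self _
      _ ≤ ‖g‖ * ‖x‖ * ‖y‖ := g.le_opNorm₂ x y
      _ ≤ 1 * ‖y‖ := by gcongr
      _ = ‖y‖ := one_mul _

/-- A point outside the compact convex zonotope would be separated from it by some `B w`,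
contradicting the bound at y = −w. -/
theorem mem_zonotope_of_forall_apply_le {B : LinearMap.BilinForm ℝ V} (hB : IsSymplectic B)
    (hV : Module.finrank ℝ V = 2) {l : List V} {x : V} (h : ∀ y, B x y ≤ zonoNorm B l y) :
    x ∈ zonotope l := by
  by_contra hx
  obtain ⟨g, r, hg, hgx⟩ := geometric_hahn_banach_closed_point (convex_zonotope l)
    (isCompact_zonotope l).isClosed hx
  obtain ⟨w, hw⟩ := hB.exists_apply_eq hV g.toLinearMap
  obtain ⟨u, hu, huw⟩ := exists_apply_eq_zonoNorm B l (-w)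
  have h1 := h (-w)
  have h2 := hg u hu
  rw [← huw, map_neg, map_neg, ← hB.apply_swap, ← hB.apply_swap, hw, hw] at h1
  exact absurd (hgx.trans_le h1) (not_lt_of_gt h2)

/-! ### Inscribed homothets -/

/-- The pairs `(x, s)` with `x + s J ⊆ C`. -/
def inscribed (J C : Set V) : Set (V × ℝ) := {z | 0 ≤ z.2 ∧ ∀ u ∈ J, z.1 + z.2 • u ∈ C}

theorem isCompact_inscribed {J C : Set V} (hC : IsCompact C) (h0 : 0 ∈ J)
    {u : V} (hu : u ∈ J) (hu0 : u ≠ 0) : IsCompact (inscribed J C) := by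
  obtain ⟨D, hD⟩ := hC.isBounded.exists_norm_le
  have hu' : 0 < ‖u‖ := norm_pos_iff.2 hu0
  refine (hC.prod (isCompact_Icc (a := (0 : ℝ)) (b := (D + D) / ‖u‖))).of_isClosed_subset ?_ ?_
  · have : inscribed J C = {z | 0 ≤ z.2} ∩ ⋂ u ∈ J, (fun z : V × ℝ => z.1 + z.2 • u) ⁻¹' C := by
      ext z; simp [inscribed]
    rw [this]
    exact (isClosed_le continuous_const continuous_snd).inter
      (isClosed_biInter fun u _ => hC.isClosed.preimage (by fun_prop))
  · rintro ⟨x, s⟩ ⟨hs, hx⟩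
    have hx0 : x ∈ C := by simpa using hx 0 h0
    refine ⟨hx0, hs, ?_⟩
    rw [le_div_iff₀ hu']
    calc s * ‖u‖ = ‖(x + s • u) - x‖ := by
          rw [add_sub_cancel_left, norm_smul, Real.norm_of_nonneg hs]
      _ ≤ ‖x + s • u‖ + ‖x‖ := norm_sub_le _ _
      _ ≤ D + D := add_le_add (hD _ (hx u hu)) (hD _ hx0)

/-! ### Bonnesen inequality, isoperimetric inequality and its equality case -/

section Area

variable [MeasurableSpace V] [BorelSpace V] {B : LinearMap.BilinForm ℝ V}
  {hB : IsSymplectic B} {hV : Module.finrank ℝ V = 2} {μ : Measure V} [μ.IsAddHaarMeasure]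
  {c : ℝ}

/-- Take the largest t for which a translate of t times the zonotope fits in C. A ball inside the
eroded set would allow a larger t, so the set equals its frontier, which is null by convexity. -/
theorem exists_measure_erosion_eq_zero [FiniteDimensional ℝ V] {C : Set V} (hC : IsConvexBody C)
    {l : List V} {u : V} (hu : u ∈ zonotope l) (hu0 : u ≠ 0) :
    ∃ t, 0 ≤ t ∧ (erosion C t l).Nonempty ∧ μ.real (erosion C t l) = 0 := by
  obtain ⟨x₀, hx₀⟩ := hC.nonempty
  obtain ⟨⟨x, t⟩, hxt, hmax⟩ := (isCompact_inscribed hC.isCompact (zero_mem_zonotope l) hu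
    hu0).exists_isMaxOn ⟨(x₀, 0), le_rfl, fun u _ => by simpa using hx₀⟩
    (continuous_snd.continuousOn)
  refine ⟨t, hxt.1, ⟨x, hxt.2⟩, ?_⟩
  have hint : interior (erosion C t l) = ∅ := by
    by_contra hne
    obtain ⟨z, hz⟩ := Set.nonempty_iff_ne_empty.2 hne
    obtain ⟨r, hr, hball⟩ := Metric.mem_nhds_iff.1 (mem_interior_iff_mem_nhds.1 hz)
    obtain ⟨D, hD⟩ := (isCompact_zonotope l).isBounded.exists_norm_le
    have hD0 : 0 ≤ D := (norm_nonneg _).trans (hD u hu)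
    have hd : 0 < r / (D + 1) := by positivity
    have : (z, t + r / (D + 1)) ∈ inscribed (zonotope l) C := by
      refine ⟨by have := hxt.1; positivity, fun v hv => ?_⟩
      have h1 : z + (r / (D + 1)) • v ∈ Metric.ball z r := by
        rw [Metric.mem_ball, dist_eq_norm, add_sub_cancel_left, norm_smul,
          Real.norm_of_nonneg hd.le, div_mul_eq_mul_div, div_lt_iff₀ (by positivity)]
        have := hD v hv
        gcongr
        linarith
      have h2 := hball h1 v hv
      rwa [add_assoc, ← add_smul, add_comm (r / (D + 1))] at h2
    have h3 : t + r / (D + 1) ≤ t := hmax this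
    linarith
  have hcl := isClosed_erosion hC.isClosed t l
  have h0 := (convex_erosion hC.convex t l).addHaar_frontier μ
  rw [hcl.frontier_eq, hint, Set.sdiff_empty] at h0
  rw [measureReal_def, h0]
  rfl

theorem IsConvexBody.measureReal_pos [FiniteDimensional ℝ V] {C : Set V} (hC : IsConvexBody C) :
    0 < μ.real C :=
  ENNReal.toReal_pos (Measure.measure_pos_of_nonempty_interior μ hC.interior_nonempty).ne'
    hC.isCompact.measure_lt_top.ne

theorem measureReal_image_add_smul (hV : Module.finrank ℝ V = 2) (v : V) {ρ : ℝ} (S : Set V) :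
    μ.real ((fun x => v + x) '' (ρ • S)) = ρ ^ 2 * μ.real S := by
  have : FiniteDimensional ℝ V := Module.finite_of_finrank_eq_succ hV
  rw [measureReal_def, measureReal_def, Set.image_add_left, measure_preimage_add,
    Measure.addHaar_smul, hV, ENNReal.toReal_mul, ENNReal.toReal_ofReal (abs_nonneg _),
    abs_of_nonneg (sq_nonneg _)]

theorem exists_zonotope_approx (hB : IsSymplectic B) (hV : Module.finrank ℝ V = 2) {k : ℝ}
    (hk : 1 < k) : ∃ l : List V, (∀ x, ‖x‖ ≤ k * zonoNorm B l x) ∧ (∀ x, zonoNorm B l x ≤ ‖x‖) := by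
  have hk0 : 0 < k := by linarith
  obtain ⟨l, hl⟩ := exists_zonoNorm_approx hB hV (ε := 1 - k⁻¹)
    (by have := inv_lt_one_of_one_lt₀ hk; linarith) (by have := inv_pos.2 hk0; linarith)
  refine ⟨l, fun x => ?_, fun x => (hl x).2⟩
  have := (hl x).1
  rw [sub_sub_cancel] at this
  rwa [inv_mul_le_iff₀ hk0] at this

theorem IsConvexBody.perimeter_ne_top (hB : IsSymplectic B) (hV : Module.finrank ℝ V = 2)
    {C : Set V} (hC : IsConvexBody C) : perimeter B C ≠ ∞ := by
  have : FiniteDimensional ℝ V := Module.finite_of_finrank_eq_succ hV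
  obtain ⟨l, hl, -⟩ := exists_zonotope_approx hB hV one_lt_two
  exact ne_top_of_le_ne_top ENNReal.ofReal_ne_top
    (perimeter_le hB hV hC.isCompact zero_le_two hl)

/-- A convex body contains a homothet of the antiball for which a Bonnesen inequality holds. -/
theorem IsConvexBody.exists_inscribed_antiball (hμ : IsAreaFactor hB hV μ c) {C : Set V}
    (hC : IsConvexBody C) : ∃ (x : V) (s : ℝ), 0 ≤ s ∧ (∀ u ∈ antiball B, x + s • u ∈ C) ∧
      μ.real C ≤ c * s * (perimeter B C).toReal - s ^ 2 * μ.real (antiball B) := by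
  have : FiniteDimensional ℝ V := Module.finite_of_finrank_eq_succ hV
  have : Nontrivial V := Module.nontrivial_of_finrank_pos (R := ℝ) (by omega)
  have hc := hμ.1
  have hI := isConvexBody_antiball hB hV
  obtain ⟨w, hw⟩ := exists_ne (0 : V)
  obtain ⟨u, hu, huw⟩ := exists_mem_antiball_apply_eq hB hV w
  have hu0 : u ≠ 0 := by
    rintro rfl
    rw [map_zero, LinearMap.zero_apply] at huw
    exact hw (norm_eq_zero.1 huw.symm)
  set P := (perimeter B C).toReal with hP
  have hP0 : 0 ≤ P := ENNReal.toReal_nonneg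
  set A := μ.real (antiball B)
  obtain ⟨x₀, hx₀⟩ := hC.nonempty
  have hcomp := isCompact_inscribed hC.isCompact (zero_mem_antiball B) hu hu0
  -- Maximising the right-hand side itself over the compact set of inscribed pairs gives one pair
  -- (x, s) that serves for all approximations.
  obtain ⟨⟨x, s⟩, hxs, hmax⟩ := hcomp.exists_isMaxOn
    (f := fun z : V × ℝ => c * z.2 * P - z.2 ^ 2 * A)
    ⟨(x₀, 0), le_rfl, fun u _ => by simpa using hx₀⟩ (by fun_prop)
  obtain ⟨R, hR⟩ := hcomp.isBounded.exists_norm_le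
  refine ⟨x, s, hxs.1, hxs.2, ?_⟩
  have key : ∀ k : ℝ, 1 < k → μ.real C ≤ c * s * P - s ^ 2 * A + (k - 1) * (c * R * P) := by
    intro k hk
    have hk0 : 0 < k := by linarith
    obtain ⟨l, hl1, hl2⟩ := exists_zonotope_approx hB hV hk
    have hsub : ∀ v ∈ antiball B, k⁻¹ • v ∈ zonotope l := by
      intro v hv
      refine mem_zonotope_of_forall_apply_le hB hV fun y => ?_
      rw [map_smul, LinearMap.smul_apply, smul_eq_mul, inv_mul_le_iff₀ hk0]
      exact (hv y).trans (hl1 y)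
    obtain ⟨t, ht, ⟨z, hz⟩, ht0⟩ := exists_measure_erosion_eq_zero (μ := μ) hC (hsub u hu)
      (smul_ne_zero (inv_ne_zero hk0.ne') hu0)
    have h1 := measure_le_measure_erosion_sub hμ hC.isCompact hC.convex ht l ⟨z, hz⟩
    rw [ht0, zero_add] at h1
    have h2 := measure_zonotope hμ l
    have h3 : k⁻¹ ^ 2 * A ≤ μ.real (zonotope l) := by
      rw [← measureReal_image_add_smul hV 0]
      refine measureReal_mono ?_ (isCompact_zonotope l).measure_lt_top.ne
      rintro _ ⟨_, ⟨v, hv, rfl⟩, rfl⟩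
      simpa using hsub v hv
    have h4 : 2 * totalWidth B l C ≤ P := by
      rw [hP, ← ENNReal.ofReal_le_iff_le_toReal (hC.perimeter_ne_top hB hV)]
      exact hC.le_perimeter hB hV hl2
    have hmem : (z, t * k⁻¹) ∈ inscribed (antiball B) C := by
      refine ⟨by positivity, fun v hv => ?_⟩
      have := hz _ (hsub v hv)
      rwa [smul_smul] at this
    have h5 : c * (t * k⁻¹) * P - (t * k⁻¹) ^ 2 * A ≤ c * s * P - s ^ 2 * A := hmax hmem
    have h6 : t * k⁻¹ ≤ R :=
      (Real.le_norm_self _).trans ((norm_snd_le (z, t * k⁻¹)).trans (hR _ hmem))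
    -- The zonotope contains k⁻¹I, so q is an admissible radius; replacing t = kq by q in the
    -- perimeter term costs at most (k − 1)cRP.
    set q := t * k⁻¹ with hq
    have htq : t = k * q := by rw [hq]; field_simp
    have h7 := mul_le_mul_of_nonneg_left h4 (mul_nonneg hc.le ht)
    have h8 := mul_le_mul_of_nonneg_left h3 (sq_nonneg t)
    have h9 : t ^ 2 * (k⁻¹ ^ 2 * A) = q ^ 2 * A := by rw [hq]; ring
    have h10 := mul_le_mul_of_nonneg_left h6
      (mul_nonneg (mul_nonneg (sub_nonneg.2 hk.le) hc.le) hP0)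
    have h11 : c * t * P = k * (c * q * P) := by rw [htq]; ring
    rw [h9, h2] at h8
    linarith
  have hlim : Filter.Tendsto (fun n : ℕ => c * s * P - s ^ 2 * A +
      (1 / ((n : ℝ) + 1)) * (c * R * P)) Filter.atTop
      (nhds (c * s * P - s ^ 2 * A + 0 * (c * R * P))) :=
    (tendsto_one_div_add_atTop_nhds_zero_nat.mul_const _).const_add _
  rw [zero_mul, add_zero] at hlim
  refine ge_of_tendsto' hlim fun n => ?_
  have := key (1 + 1 / ((n : ℝ) + 1)) (by have : (0 : ℝ) < 1 / ((n : ℝ) + 1) := by positivity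
                                          linarith)
  rwa [add_sub_cancel_left] at this

theorem isConvexBody_image_antiball (hB : IsSymplectic B) (hV : Module.finrank ℝ V = 2) (v : V)
    {ρ : ℝ} (hρ : 0 < ρ) : IsConvexBody ((fun x => v + x) '' (ρ • antiball B)) := by
  have hI := isConvexBody_antiball hB hV
  refine ⟨(hI.convex.smul ρ).translate v, ?_, ?_, ?_⟩
  · exact (Homeomorph.addLeft v).isClosedMap _ ((Homeomorph.smulOfNeZero ρ hρ.ne').isClosedMap _
      hI.isClosed)
  · have := hI.isBounded.smul₀ ρ
    rw [isBounded_iff_forall_norm_le] at this ⊢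
    obtain ⟨D, hD⟩ := this
    refine ⟨‖v‖ + D, ?_⟩
    rintro _ ⟨x, hx, rfl⟩
    exact (norm_add_le _ _).trans (add_le_add le_rfl (hD x hx))
  · have h1 : (interior (ρ • antiball B)).Nonempty := by
      rw [interior_smul₀ hρ.ne']
      exact hI.interior_nonempty.smul_set
    have h2 := (Homeomorph.addLeft v).image_interior (ρ • antiball B)
    change (fun x => v + x) '' _ = interior ((fun x => v + x) '' _) at h2
    rw [← h2]
    exact h1.image _

/-- The width of ρI along `B a` is at most 2ρ‖a‖, so its total width is at most 2ρk·zonoArea, and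
2c·zonoArea is the area of a zonotope inside I. Then k tends to 1. -/
theorem perimeter_image_antiball_le (hμ : IsAreaFactor hB hV μ c) (v : V) {ρ : ℝ} (hρ : 0 < ρ) :
    c * (perimeter B ((fun x => v + x) '' (ρ • antiball B))).toReal ≤
      2 * ρ * μ.real (antiball B) := by
  have : FiniteDimensional ℝ V := Module.finite_of_finrank_eq_succ hV
  have hc := hμ.1
  have hbody := isConvexBody_image_antiball hB hV v hρ
  set C := (fun x => v + x) '' (ρ • antiball B) with hC
  have key : ∀ k : ℝ, 1 < k →
      c * (perimeter B C).toReal ≤ k ^ 2 * (2 * ρ * μ.real (antiball B)) := by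
    intro k hk
    have hk0 : 0 < k := by linarith
    obtain ⟨l, hl1, hl2⟩ := exists_zonotope_approx hB hV hk
    have h1 : totalWidth B l C ≤ 2 * ρ * k * zonoArea B l := by
      rw [totalWidth, zonoArea, ← List.sum_map_mul_left]
      refine List.sum_le_sum fun a _ => ?_
      have hna : 2 * ρ * ‖a‖ ≤ 2 * ρ * k * zonoNorm B l a := by
        rw [mul_assoc _ k]
        exact mul_le_mul_of_nonneg_left (hl1 a) (by positivity)
      refine le_trans (width_le (by positivity) ?_) hna
      rintro _ ⟨_, ⟨x, hx, rfl⟩, rfl⟩ _ ⟨_, ⟨y, hy, rfl⟩, rfl⟩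
      have e1 := hx (-a)
      have e2 := hy a
      rw [map_neg, norm_neg, ← hB.apply_swap] at e1
      rw [hB.apply_swap a y] at e2
      simp only [add_sub_add_left_eq_sub, ← smul_sub, map_smul, smul_eq_mul, map_sub]
      rw [mul_comm 2 ρ, mul_assoc]
      exact mul_le_mul_of_nonneg_left (by linarith) hρ.le
    have h2 : (perimeter B C).toReal ≤ 2 * k * totalWidth B l C :=
      ENNReal.toReal_le_of_le_ofReal
        (mul_nonneg (by positivity) (totalWidth_nonneg B l hbody.isCompact))
        (perimeter_le hB hV hbody.isCompact hk0.le hl1)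
    have h3 : 2 * c * zonoArea B l ≤ μ.real (antiball B) := by
      rw [← measure_zonotope hμ l]
      refine measureReal_mono (fun x hx y => (apply_le_zonoNorm B hx y).trans (hl2 y))
        (isConvexBody_antiball hB hV).isCompact.measure_lt_top.ne
    calc c * (perimeter B C).toReal ≤ c * (2 * k * totalWidth B l C) := by gcongr
      _ ≤ c * (2 * k * (2 * ρ * k * zonoArea B l)) := by gcongr
      _ = k ^ 2 * (2 * ρ * (2 * c * zonoArea B l)) := by ring
      _ ≤ _ := by gcongr
  have hlim : Filter.Tendsto (fun n : ℕ => (1 + 1 / ((n : ℝ) + 1)) ^ 2 *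
      (2 * ρ * μ.real (antiball B))) Filter.atTop
      (nhds ((1 + 0) ^ 2 * (2 * ρ * μ.real (antiball B)))) :=
    ((tendsto_one_div_add_atTop_nhds_zero_nat.const_add 1).pow 2).mul_const _
  rw [add_zero, one_pow, one_mul] at hlim
  exact ge_of_tendsto' hlim fun n => key _ (by
    have : (0 : ℝ) < 1 / ((n : ℝ) + 1) := by positivity
    linarith)

/-- The isoperimetric inequality in a Minkowski plane. -/
theorem IsConvexBody.isoperimetric (hμ : IsAreaFactor hB hV μ c) {C : Set V}
    (hC : IsConvexBody C) :
    4 * μ.real (antiball B) * μ.real C ≤ (c * (perimeter B C).toReal) ^ 2 := by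
  have : FiniteDimensional ℝ V := Module.finite_of_finrank_eq_succ hV
  obtain ⟨x, s, hs, -, h⟩ := hC.exists_inscribed_antiball hμ
  have hA := (isConvexBody_antiball hB hV).measureReal_pos (μ := μ)
  -- Uses 4A(csP − s²A) = (cP)² − (cP − 2sA)².
  nlinarith [sq_nonneg (c * (perimeter B C).toReal - 2 * s * μ.real (antiball B))]

/-- The equality case of the isoperimetric inequality in a Minkowski plane. -/
theorem IsConvexBody.isAnticircle_of_isoperimetric_eq (hμ : IsAreaFactor hB hV μ c) {C : Set V}
    (hC : IsConvexBody C)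
    (heq : (c * (perimeter B C).toReal) ^ 2 ≤ 4 * μ.real (antiball B) * μ.real C) :
    IsAnticircle B C := by
  have : FiniteDimensional ℝ V := Module.finite_of_finrank_eq_succ hV
  have : Nontrivial V := Module.nontrivial_of_finrank_pos (R := ℝ) (by omega)
  obtain ⟨x, s, hs, hsub, h⟩ := hC.exists_inscribed_antiball hμ
  have hA := (isConvexBody_antiball hB hV).measureReal_pos (μ := μ)
  have hC0 := hC.measureReal_pos (μ := μ)
  set A := μ.real (antiball B)
  set P := (perimeter B C).toReal
  have h1 : c * P - 2 * s * A = 0 := by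
    have : (c * P - 2 * s * A) ^ 2 ≤ 0 := by nlinarith
    exact pow_eq_zero_iff (two_ne_zero) |>.1 (le_antisymm this (sq_nonneg _))
  have h2 : μ.real C ≤ s ^ 2 * A := by
    have : c * s * P = s * (2 * s * A) := by rw [← sub_eq_zero.1 h1]; ring
    linarith
  have hs0 : 0 < s := by
    refine hs.lt_of_ne fun h0 => ?_
    rw [← h0] at h2
    linarith
  refine ⟨x, s, hs0, ?_⟩
  rw [setOf_antinorm_le_eq B x hs0]
  have hbody := isConvexBody_image_antiball hB hV x hs0
  have hD := measureReal_image_add_smul (μ := μ) hV x (ρ := s) (antiball B)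
  set D := (fun y => x + y) '' (s • antiball B) with hDdef
  have hDC : D ⊆ C := by
    rintro _ ⟨_, ⟨u, hu, rfl⟩, rfl⟩
    exact hsub u hu
  refine subset_antisymm ?_ hDC
  have hnull : μ (C \ D) = 0 := by
    have h3 := measureReal_sdiff (μ := μ) hDC hbody.isClosed.measurableSet
      hC.isCompact.measure_lt_top.ne
    have h4 : μ.real (C \ D) = 0 := le_antisymm (by rw [h3, hD]; linarith) measureReal_nonneg
    rwa [measureReal_eq_zero_iff (measure_ne_top_of_subset Set.sdiff_subset
      hC.isCompact.measure_lt_top.ne)] at h4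
  -- An open null set is empty, so the closed set D contains the interior of C, whose closure is C.
  have hopen : interior C \ D = ∅ := by
    by_contra hne
    have := (isOpen_interior.sdiff hbody.isClosed).measure_pos μ
      (Set.nonempty_iff_ne_empty.2 hne)
    exact this.ne' (measure_mono_null (Set.sdiff_subset_sdiff_left interior_subset) hnull)
  calc C = closure (interior C) := by
        rw [hC.convex.closure_interior_eq_closure_of_nonempty_interior hC.interior_nonempty,
          hC.isClosed.closure_eq]
    _ ⊆ D := closure_minimal (Set.sdiff_eq_empty.1 hopen) hbody.isClosed

theorem IsAnticircle.isConvexBody (hB : IsSymplectic B) (hV : Module.finrank ℝ V = 2)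
    {C : Set V} (hC : IsAnticircle B C) : IsConvexBody C := by
  have : FiniteDimensional ℝ V := Module.finite_of_finrank_eq_succ hV
  have : Nontrivial V := Module.nontrivial_of_finrank_pos (R := ℝ) (by omega)
  obtain ⟨v, ρ, hρ, rfl⟩ := hC
  rw [setOf_antinorm_le_eq B v hρ]
  exact isConvexBody_image_antiball hB hV v hρ

theorem IsAnticircle.isoperimetric_eq (hμ : IsAreaFactor hB hV μ c) {C : Set V}
    (hC : IsAnticircle B C) :
    (c * (perimeter B C).toReal) ^ 2 = 4 * μ.real (antiball B) * μ.real C := by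
  have : FiniteDimensional ℝ V := Module.finite_of_finrank_eq_succ hV
  have : Nontrivial V := Module.nontrivial_of_finrank_pos (R := ℝ) (by omega)
  refine le_antisymm ?_ ((hC.isConvexBody hB hV).isoperimetric hμ)
  obtain ⟨v, ρ, hρ, rfl⟩ := hC
  rw [setOf_antinorm_le_eq B v hρ, measureReal_image_add_smul hV]
  have h := perimeter_image_antiball_le hμ v hρ
  have h0 : 0 ≤ c * (perimeter B ((fun x => v + x) '' (ρ • antiball B))).toReal :=
    mul_nonneg hμ.1.le ENNReal.toReal_nonneg
  calc _ ≤ (2 * ρ * μ.real (antiball B)) ^ 2 := pow_le_pow_left₀ h0 h 2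
    _ = _ := by ring

theorem IsConvexBody.isoperimetricRatio_eq (hB : IsSymplectic B) (hV : Module.finrank ℝ V = 2)
    {C : Set V} (hC : IsConvexBody C) :
    isoperimetricRatio B μ C = ENNReal.ofReal ((perimeter B C).toReal ^ 2 / μ.real C) := by
  have : FiniteDimensional ℝ V := Module.finite_of_finrank_eq_succ hV
  rw [ENNReal.ofReal_div_of_pos hC.measureReal_pos, ENNReal.ofReal_pow ENNReal.toReal_nonneg,
    ENNReal.ofReal_toReal (hC.perimeter_ne_top hB hV), measureReal_def,
    ENNReal.ofReal_toReal hC.isCompact.measure_lt_top.ne, isoperimetricRatio]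

end Area

end MinkowskiPlane

/-! ### The two characterisations of anticircles -/

open MinkowskiPlane in
theorem theorem10p8 {V : Type*} [NormedAddCommGroup V] [NormedSpace ℝ V]
    [MeasurableSpace V] [BorelSpace V] (hV : Module.finrank ℝ V = 2)
    (B : LinearMap.BilinForm ℝ V) (hB : MinkowskiPlane.IsSymplectic B)
    (μ : Measure V) [μ.IsAddHaarMeasure] (C : Set V) :
    ((MinkowskiPlane.IsConvexBody C ∧
        ∀ D : Set V, MinkowskiPlane.IsConvexBody D →
          MinkowskiPlane.isoperimetricRatio B μ C ≤ MinkowskiPlane.isoperimetricRatio B μ D) ↔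
      MinkowskiPlane.IsAnticircle B C) ∧
    ((MinkowskiPlane.IsConvexBody C ∧
        ∀ D : Set V, MinkowskiPlane.IsConvexBody D →
          MinkowskiPlane.perimeter B D = MinkowskiPlane.perimeter B C → μ D ≤ μ C) ↔
      MinkowskiPlane.IsAnticircle B C) := by
  have : FiniteDimensional ℝ V := Module.finite_of_finrank_eq_succ hV
  have : Nontrivial V := Module.nontrivial_of_finrank_pos (R := ℝ) (by omega)
  obtain ⟨c, hμ⟩ := exists_measure_eq_chart hB hV μ
  replace hμ : IsAreaFactor hB hV μ c := hμ
  have hc := hμ.1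
  have hA := (isConvexBody_antiball hB hV).measureReal_pos (μ := μ)
  have hball : ∀ ρ : ℝ, 0 < ρ → IsAnticircle B {x : V | antinorm B (x - 0) ≤ ρ} :=
    fun ρ hρ => ⟨0, ρ, hρ, rfl⟩
  constructor
  · constructor
    · rintro ⟨hC, hmin⟩
      have hD := hball 1 one_pos
      have hD' := hD.isConvexBody hB hV
      have h := hmin _ hD'
      rw [hC.isoperimetricRatio_eq hB hV, hD'.isoperimetricRatio_eq hB hV,
        ENNReal.ofReal_le_ofReal_iff (by positivity),
        div_le_div_iff₀ hC.measureReal_pos hD'.measureReal_pos] at h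
      refine hC.isAnticircle_of_isoperimetric_eq hμ ?_
      have heq := hD.isoperimetric_eq hμ
      refine le_of_mul_le_mul_right ?_ (hD'.measureReal_pos (μ := μ))
      rw [mul_pow] at heq ⊢
      have := mul_le_mul_of_nonneg_left h (sq_nonneg c)
      rw [← mul_assoc, ← mul_assoc, heq] at this
      linarith
    · intro hC
      have hC' := hC.isConvexBody hB hV
      refine ⟨hC', fun D hD => ?_⟩
      rw [hC'.isoperimetricRatio_eq hB hV, hD.isoperimetricRatio_eq hB hV]
      refine ENNReal.ofReal_le_ofReal ?_
      rw [div_le_div_iff₀ hC'.measureReal_pos hD.measureReal_pos]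
      refine le_of_mul_le_mul_left ?_ (pow_pos hc 2)
      have h1 := hC.isoperimetric_eq hμ
      have h2 := mul_le_mul_of_nonneg_right (hD.isoperimetric hμ)
        (hC'.measureReal_pos (μ := μ)).le
      rw [mul_pow] at h1 h2
      rw [← mul_assoc, ← mul_assoc, h1]
      linarith
  · constructor
    · rintro ⟨hC, hmax⟩
      refine hC.isAnticircle_of_isoperimetric_eq hμ ?_
      set P := (perimeter B C).toReal with hP
      have hP0 : 0 < P := by
        have h1 := hC.isoperimetric hμ
        have h2 : 0 < 4 * μ.real (antiball B) * μ.real C := by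
          have := hC.measureReal_pos (μ := μ)
          positivity
        refine ENNReal.toReal_nonneg.lt_of_ne fun h0 => ?_
        rw [← h0, mul_zero] at h1
        linarith
      -- This radius gives the anticircle the same perimeter as C, since an anticircle of radius ρ
      -- satisfies c·per = 2ρA.
      set ρ := c * P / (2 * μ.real (antiball B)) with hρ
      have hρ0 : 0 < ρ := by positivity
      have hD := hball ρ hρ0
      have hD' := hD.isConvexBody hB hV
      have hDarea : μ.real {x : V | antinorm B (x - 0) ≤ ρ} = ρ ^ 2 * μ.real (antiball B) := by
        rw [setOf_antinorm_le_eq B 0 hρ0, measureReal_image_add_smul hV]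
      have heq := hD.isoperimetric_eq hμ
      rw [hDarea] at heq
      have hper : (perimeter B {x : V | antinorm B (x - 0) ≤ ρ}).toReal = P := by
        have h1 : (c * (perimeter B {x : V | antinorm B (x - 0) ≤ ρ}).toReal) ^ 2 =
            (c * P) ^ 2 := by
          rw [heq, hρ]
          field_simp
          norm_num
        have h2 := (pow_left_inj₀ (mul_nonneg hc.le ENNReal.toReal_nonneg)
          (mul_nonneg hc.le hP0.le) two_ne_zero).1 h1
        exact mul_left_cancel₀ hc.ne' h2
      have h := hmax _ hD' ((ENNReal.toReal_eq_toReal_iff' (hD'.perimeter_ne_top hB hV)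
        (hC.perimeter_ne_top hB hV)).1 hper)
      have h' := ENNReal.toReal_mono hC.isCompact.measure_lt_top.ne h
      rw [← measureReal_def, ← measureReal_def] at h'
      rw [← hper, hD.isoperimetric_eq hμ]
      exact mul_le_mul_of_nonneg_left h' (by positivity)
    · intro hC
      have hC' := hC.isConvexBody hB hV
      refine ⟨hC', fun D hD hper => ?_⟩
      have h1 := hC.isoperimetric_eq hμ
      have h2 := hD.isoperimetric hμ
      rw [hper, h1] at h2
      have h3 : μ.real D ≤ μ.real C := le_of_mul_le_mul_left h2 (by positivity)
      exact (ENNReal.toReal_le_toReal hD.isCompact.measure_lt_top.ne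
        hC'.isCompact.measure_lt_top.ne).1 h3
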